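/- Let $\mathbf{R}^N=\mathbf{R}^{N_1}\times\dots\times\mathbf{R}^{N_n}$ with the standard inner product; write $x^{(i)}\in\mathbf{R}^{N_i}$ for the $i$-th block of $x$, $U_i t\in\mathbf{R}^N$ for the vector whose $i$-th block is $t$ and whose other blocks are zero, and $[n]=\{1,\dots,n\}$. Each $\mathbf{R}^{N_i}$ carries a Euclidean norm $\|t\|_{(i)}=\langle B_i t,t\rangle^{1/2}$, where $B_i$ is a positive definite matrix, with conjugate norm $\|t\|_{(i)}^*=\max_{\|s\|_{(i)}\le 1}\langle s,t\rangle$. For $w\in\mathbf{R}^n_{>0}$ put $\|x\|_w=\big(\sum_{i=1}^n w_i\|x^{(i)}\|_{(i)}^2\big)^{1/2}$. Let $F=f+\Omega$, where: (1) $f=\sum_{J\in\mathcal J}f_J:\mathbf{R}^N\to\mathbf{R}$, $\mathcal J$ is a collection of subsets of $[n]$, each $f_J$ is convex and depends on the blocks $x^{(i)}$, $i\in J$, only; $f$ is differentiable and, with $\nabla_i f(x)=(\nabla f(x))^{(i)}$, there are constants $L_1,\dots,L_n>0$ such that $\|\nabla_i f(x+U_it)-\nabla_i f(x)\|_{(i)}^*\le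 L_i\|t\|_{(i)}$ for all $x\in\mathbf{R}^N$, $i\in[n]$, $t\in\mathbf{R}^{N_i}$; (2) $\Omega(x)=\sum_{i=1}^n\Omega_i(x^{(i)})$, where each $\Omega_i:\mathbf{R}^{N_i}\to\mathbf{R}\cup\{+\infty\}$ is convex and closed; (3) $[n]$ is partitioned into $C\ge 1$ sets $P^{(1)},\dots,P^{(C)}$ of the same size $s=n/C$, and $\tau\in\{1,\dots,s\}$. For $k\ge 0$ and $c\in\{1,\dots,C\}$, the random set $Z_k^{(c)}$ is uniformly distributed over the subsets of $P^{(c)}$ of cardinality $\tau$, all the $Z_k^{(c)}$ are independent, and $Z_k=\bigcup_{c=1}^C Z_k^{(c)}$. Let $\xi=\max\{|P^{(c)}\cap J| : 1\le c\le C,\ J\in\mathcal J\}$, $$\beta=1+\frac{(\xi-1)(\tau-1)}{\max\{1,s-1\}}+(C-1)\frac{\xi\tau}{s},\qquad w_i=L_i .$$ For $x\in\mathbf{R}^N$ and $i\in[n]$ let $$h^{(i)}(x)\in\arg\min_{t\in\mathbf{R}^{N_i}}\ \langle\nabla_i f(x),t\rangle+\frac{\beta w_i}{2}\|t\|_{(i)}^2+\Omega_i(x^{(i)}+t),$$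 and, from a given $x_0\in\mathbf{R}^N$, let $x_{k+1}=x_k+\sum_{i\in Z_k}U_ih^{(i)}(x_k)$ for $k\ge0$. Let $x^*$ be a minimizer of $F$ with $F^*:=F(x^*)=\inf F<+\infty$. Then for all $k\ge1$, $$\mathbf{E}[F(x_k)-F^*]\le\frac{n}{n+C\tau k}\left(\frac{\beta}{2}\|x_0-x^*\|_w^2+F(x_0)-F^*\right).$$ In particular the rate is $O(1/\epsilon)$: for every $\epsilon>0$ and every $k\ge1$ with $k\ge\frac{n}{C\tau\epsilon}\left(\frac{\beta}{2}\|x_0-x^*\|_w^2+F(x_0)-F^*\right)$ one has $\mathbf{E}[F(x_k)-F^*]\le\epsilon$. -/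

import Mathlib

open scoped InnerProductSpace ENNReal

noncomputable section

namespace DBCD

/-- `ℝ^N` split into `n` blocks, the `i`-th of dimension `d i` (so `N = ∑ i, d i`), with the standard
inner product. The `i`-th block of `x` is `x i`, and `U_i t` is `PiLp.single 2 i t`. -/
abbrev BlockSpace {n : ℕ} (d : Fin n → ℕ) : Type :=
  PiLp 2 (fun i : Fin n => EuclideanSpace ℝ (Fin (d i)))

/-- The Euclidean norm `‖t‖ = ⟨B t, t⟩^{1/2}` given by a positive definite matrix `B`. -/
def blockNorm {m : ℕ} (B : Matrix (Fin m) (Fin m) ℝ) (t : EuclideanSpace ℝ (Fin m)) : ℝ :=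
  Real.sqrt ⟪Matrix.toEuclideanLin B t, t⟫_ℝ

/-- The conjugate norm `‖t‖^* = max {⟨s, t⟩ : ‖s‖ ≤ 1}`. -/
def dualBlockNorm {m : ℕ} (B : Matrix (Fin m) (Fin m) ℝ) (t : EuclideanSpace ℝ (Fin m)) : ℝ :=
  sSup {r : ℝ | ∃ s : EuclideanSpace ℝ (Fin m), blockNorm B s ≤ 1 ∧ r = ⟪s, t⟫_ℝ}

/-- The weighted norm `‖x‖_w = (∑ i, w_i ‖x^{(i)}‖_{(i)}^2)^{1/2}`. -/
def weightedNorm {n : ℕ} {d : Fin n → ℕ} (B : ∀ i, Matrix (Fin (d i)) (Fin (d i)) ℝ)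
    (w : Fin n → ℝ) (x : BlockSpace d) : ℝ :=
  Real.sqrt (∑ i, w i * blockNorm (B i) (x i) ^ 2)

/-- The block `∇_i f(x)` of the gradient of `f` at `x`. -/
def blockGradient {n : ℕ} {d : Fin n → ℕ} (f : BlockSpace d → ℝ) (i : Fin n) (x : BlockSpace d) :
    EuclideanSpace ℝ (Fin (d i)) :=
  (gradient f x) i

/-- The assumptions on `f`: it is the sum over `J ∈ 𝒥` of convex functions `f_J`, where `f_J`
depends on the blocks in `J` only, and it is differentiable with a block Lipschitz gradient,
with positive constants `L_1, …, L_n`. -/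
structure SmoothPartiallySeparable {n : ℕ} {d : Fin n → ℕ}
    (B : ∀ i, Matrix (Fin (d i)) (Fin (d i)) ℝ) (𝒥 : Finset (Finset (Fin n)))
    (fJ : Finset (Fin n) → BlockSpace d → ℝ) (L : Fin n → ℝ) (f : BlockSpace d → ℝ) : Prop where
  sum_eq : ∀ x, f x = ∑ J ∈ 𝒥, fJ J x
  depends : ∀ J ∈ 𝒥, ∀ x y : BlockSpace d, (∀ i ∈ J, x i = y i) → fJ J x = fJ J y
  convex : ∀ J ∈ 𝒥, ConvexOn ℝ Set.univ (fJ J)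
  differentiable : Differentiable ℝ f
  lipschitz_pos : ∀ i, 0 < L i
  lipschitz : ∀ (x : BlockSpace d) (i : Fin n) (t : EuclideanSpace ℝ (Fin (d i))),
    dualBlockNorm (B i) (blockGradient f i (x + PiLp.single 2 i t) - blockGradient f i x)
      ≤ L i * blockNorm (B i) t

/-- `g : E → ℝ ∪ {+∞}` is convex and closed: its epigraph is convex and closed. -/
structure ClosedConvex {E : Type*} [NormedAddCommGroup E] [NormedSpace ℝ E] (g : E → EReal) :
    Prop where
  ne_bot : ∀ t, g t ≠ ⊥
  convex_epigraph : Convex ℝ {p : E × ℝ | g p.1 ≤ (p.2 : EReal)}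
  closed_epigraph : IsClosed {p : E × ℝ | g p.1 ≤ (p.2 : EReal)}

/-- The block separable function `Ω(x) = ∑ i, Ω_i(x^{(i)})`. -/
def separable {n : ℕ} {d : Fin n → ℕ} (Om : ∀ i, EuclideanSpace ℝ (Fin (d i)) → EReal)
    (x : BlockSpace d) : EReal :=
  ∑ i, Om i (x i)

/-- The objective `F(x) = f(x) + Ω(x)`. -/
def objective {n : ℕ} {d : Fin n → ℕ} (f : BlockSpace d → ℝ)
    (Om : ∀ i, EuclideanSpace ℝ (Fin (d i)) → EReal) (x : BlockSpace d) : EReal :=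
  (f x : EReal) + separable Om x

/-- `P_1, …, P_C` partition the set of blocks into groups of the same size `s`. -/
structure BalancedPartition {n C : ℕ} (P : Fin C → Finset (Fin n)) (s : ℕ) : Prop where
  cover : ∀ i, ∃ c, i ∈ P c
  disjoint : ∀ c c', c ≠ c' → Disjoint (P c) (P c')
  card_eq : ∀ c, (P c).card = s

/-- `Z k c` is the random set of blocks drawn by computer `c` in iteration `k`. It is uniformly
distributed over the subsets of `P c` of cardinality `τ`, and all these draws (over all iterations
and all computers) are independent. Hence the sets `⋃ c, Z k c` are iid `(C, τ)`-distributed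
samplings. -/
structure DistributedSamplings {n C : ℕ} {S : Type*} [MeasurableSpace S]
    (μ : MeasureTheory.Measure S) (P : Fin C → Finset (Fin n)) (τ : ℕ)
    (Z : ℕ → Fin C → S → Finset (Fin n)) : Prop where
  measurable : ∀ k c, Measurable (Z k c)
  law : ∀ k c, μ.map (Z k c) =
    ProbabilityTheory.uniformOn ((Finset.powersetCard τ (P c) : Finset (Finset (Fin n))) :
      Set (Finset (Fin n)))
  indep : ProbabilityTheory.iIndepFun (fun q : ℕ × Fin C => Z q.1 q.2) μ

/-- The union `Z_k = ⋃ c, Z_k^{(c)}` of the sets drawn by all the computers. -/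
def sampledBlocks {n C : ℕ} {S : Type*} (Z : ℕ → Fin C → S → Finset (Fin n)) (k : ℕ) (ω : S) :
    Finset (Fin n) :=
  Finset.univ.biUnion (fun c => Z k c ω)

/-- `ξ = max {|P_c ∩ J| : c, J ∈ 𝒥}`. -/
def xi {n C : ℕ} (P : Fin C → Finset (Fin n)) (𝒥 : Finset (Finset (Fin n))) : ℕ :=
  ((Finset.univ : Finset (Fin C)) ×ˢ 𝒥).sup (fun q => (P q.1 ∩ q.2).card)

/-- `β = 1 + (ξ - 1)(τ - 1) / max{1, s - 1} + (C - 1) ξ τ / s`. -/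
def stepBeta (C s τ ξ : ℕ) : ℝ :=
  1 + ((ξ : ℝ) - 1) * ((τ : ℝ) - 1) / max 1 ((s : ℝ) - 1) + ((C : ℝ) - 1) * ((ξ : ℝ) * τ / s)

/-- The objective of the subproblem that defines the update of block `i` at `x`,
`t ↦ ⟨∇_i f(x), t⟩ + (β w_i / 2) ‖t‖_{(i)}^2 + Ω_i(x^{(i)} + t)`. -/
def blockModel {n : ℕ} {d : Fin n → ℕ} (B : ∀ i, Matrix (Fin (d i)) (Fin (d i)) ℝ)
    (f : BlockSpace d → ℝ) (Om : ∀ i, EuclideanSpace ℝ (Fin (d i)) → EReal)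
    (β : ℝ) (w : Fin n → ℝ) (x : BlockSpace d) (i : Fin n) (t : EuclideanSpace ℝ (Fin (d i))) :
    EReal :=
  ((⟪blockGradient f i x, t⟫_ℝ + β * w i / 2 * blockNorm (B i) t ^ 2 : ℝ) : EReal)
    + Om i (x i + t)

/-- The blocks `h^{(i)}(x)` of `h x` solve the block subproblems at `x`, for every `x`. -/
def IsBlockUpdate {n : ℕ} {d : Fin n → ℕ} (B : ∀ i, Matrix (Fin (d i)) (Fin (d i)) ℝ)
    (f : BlockSpace d → ℝ) (Om : ∀ i, EuclideanSpace ℝ (Fin (d i)) → EReal)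
    (β : ℝ) (w : Fin n → ℝ) (h : BlockSpace d → BlockSpace d) : Prop :=
  ∀ x i, IsMinOn (blockModel B f Om β w x i) Set.univ (h x i)

/-- The iterates: `x_{k+1} = x_k + ∑_{i ∈ Z_k} U_i h^{(i)}(x_k)`, from the starting point `x₀`. -/
def iterate {n C : ℕ} {d : Fin n → ℕ} {S : Type*} (h : BlockSpace d → BlockSpace d)
    (Z : ℕ → Fin C → S → Finset (Fin n)) (x₀ : BlockSpace d) : ℕ → S → BlockSpace d
  | 0, _ => x₀
  | k + 1, ω => iterate h Z x₀ k ω +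
      ∑ i ∈ sampledBlocks Z k ω, PiLp.single 2 i (h (iterate h Z x₀ k ω) i)

/-- `F^* = inf F`. -/
def optimalValue {n : ℕ} {d : Fin n → ℕ} (f : BlockSpace d → ℝ)
    (Om : ∀ i, EuclideanSpace ℝ (Fin (d i)) → EReal) : EReal :=
  ⨅ x : BlockSpace d, objective f Om x

/-- The optimality gap `F(x) - F^*`, as an element of `[0, ∞]` (when `F^*` is finite, nothing is
truncated, and the gap is `∞` exactly when `F(x) = +∞`). -/
def gap {n : ℕ} {d : Fin n → ℕ} (f : BlockSpace d → ℝ)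
    (Om : ∀ i, EuclideanSpace ℝ (Fin (d i)) → EReal) (x : BlockSpace d) : ℝ≥0∞ :=
  (objective f Om x - optimalValue f Om).toENNReal

/-- `(β / 2) ‖x₀ - x^*‖_w^2 + F(x₀) - F^*`. -/
def initialError {n : ℕ} {d : Fin n → ℕ} (B : ∀ i, Matrix (Fin (d i)) (Fin (d i)) ℝ)
    (f : BlockSpace d → ℝ) (Om : ∀ i, EuclideanSpace ℝ (Fin (d i)) → EReal)
    (β : ℝ) (w : Fin n → ℝ) (x₀ xstar : BlockSpace d) : ℝ≥0∞ :=
  ENNReal.ofReal (β / 2 * weightedNorm B w (x₀ - xstar) ^ 2) + gap f Om x₀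

end DBCD

end

/-! The proof combines an expected separable overapproximation of `f` with a potential argument.

Overapproximation (`SmoothPartiallySeparable.sum_samplings_le`): averaged over the samplings, `f` at
a joint step `t` in the blocks of `Z` is at most `f x` plus `τ / s` times the sum over all blocks of
`⟨∇_i f(x), t_i⟩ + (β L_i / 2) ‖t_i‖²`. Only `f` has Lipschitz block gradients; the `f_J` are merely
convex. So each `J` is padded to a set `J'` with exactly `ξ` blocks in every part, and convexity
bounds `f_J` at the joint step by an average of single block steps stretched by `k = |J' ∩ Z|`
(`convex_joint_step_le`). The number of samplings `Z ∋ i` with `|J' ∩ Z| = k` depends neither on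
`J'` nor on `i ∈ J'` (`BalancedPartition.card_filter_mem_card_inter_eq`). All `f_J` thus get the
same coefficients, and summing over `J` restores `f` before smoothness is used. The Lipschitz bound
for a stretched step, divided by `k`, carries a factor `k` on the quadratic term; the mean of `|J' ∩
Z|` given `i ∈ Z` is exactly `β` (`BalancedPartition.sum_filter_mem_card_inter`).

Potential: the block model is strongly convex, so its minimizer satisfies a three-point inequality
(`IsBlockUpdate.realBlockModel_add_le`). With convexity of `f` this shows that `(β / 2) ‖x - x^*‖_w²
+ F(x) - F^*` decreases in mean by at least `τ / s` times the current gap, while the mean gap itself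
never increases. Telescoping gives `(1 + k τ / s) E[F(x_k) - F^*] ≤` the initial potential, and `n =
C s` turns the factor into the stated rate. -/

namespace DBCD

/-! ### Block norms and their conjugates -/

section BlockNorm

variable {m : ℕ} {B : Matrix (Fin m) (Fin m) ℝ}

theorem inner_toEuclideanLin_symm (hB : B.PosDef) (s t : EuclideanSpace ℝ (Fin m)) :
    ⟪Matrix.toEuclideanLin B s, t⟫_ℝ = ⟪Matrix.toEuclideanLin B t, s⟫_ℝ := by
  have := (Matrix.isSymmetric_toEuclideanLin_iff (𝕜 := ℝ)).2 hB.isHermitian s t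
  rw [this, real_inner_comm]

theorem inner_toEuclideanLin_nonneg (hB : B.PosDef) (t : EuclideanSpace ℝ (Fin m)) :
    0 ≤ ⟪Matrix.toEuclideanLin B t, t⟫_ℝ := by
  rw [real_inner_comm]
  have := hB.posSemidef.dotProduct_mulVec_nonneg t.ofLp
  simpa [EuclideanSpace.inner_eq_star_dotProduct, dotProduct_comm] using this

theorem blockNorm_sq (hB : B.PosDef) (t : EuclideanSpace ℝ (Fin m)) :
    blockNorm B t ^ 2 = ⟪Matrix.toEuclideanLin B t, t⟫_ℝ :=
  Real.sq_sqrt (inner_toEuclideanLin_nonneg hB t)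

theorem blockNorm_nonneg (t : EuclideanSpace ℝ (Fin m)) : 0 ≤ blockNorm B t :=
  Real.sqrt_nonneg _

theorem blockNorm_smul (a : ℝ) (t : EuclideanSpace ℝ (Fin m)) :
    blockNorm B (a • t) = |a| * blockNorm B t := by
  unfold blockNorm
  rw [map_smul, real_inner_smul_left, real_inner_smul_right, ← mul_assoc,
    Real.sqrt_mul (mul_self_nonneg a), Real.sqrt_mul_self_eq_abs]

/-- The exact defect of convexity of the squared norm; its last term is the source of the strong
minimality of the block update. -/
theorem blockNorm_sq_convex_combination (hB : B.PosDef) (s t : EuclideanSpace ℝ (Fin m)) (a : ℝ) :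
    blockNorm B ((1 - a) • s + a • t) ^ 2 =
      (1 - a) * blockNorm B s ^ 2 + a * blockNorm B t ^ 2
        - a * (1 - a) * blockNorm B (t - s) ^ 2 := by
  simp only [blockNorm_sq hB, map_add, map_sub, map_smul, inner_add_left, inner_add_right,
    inner_sub_left, inner_sub_right, real_inner_smul_left, real_inner_smul_right]
  rw [inner_toEuclideanLin_symm hB t s]
  ring

/-- Cauchy–Schwarz for the form of `B`: the quadratic `a ↦ ‖s + a t‖²` is nonnegative, so its
discriminant is nonpositive. -/
theorem inner_toEuclideanLin_le (hB : B.PosDef) (s t : EuclideanSpace ℝ (Fin m)) :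
    ⟪Matrix.toEuclideanLin B s, t⟫_ℝ ≤ blockNorm B s * blockNorm B t := by
  have key : ∀ a : ℝ, 0 ≤ (blockNorm B t ^ 2) * (a * a)
      + (2 * ⟪Matrix.toEuclideanLin B s, t⟫_ℝ) * a + blockNorm B s ^ 2 := by
    intro a
    have h0 := inner_toEuclideanLin_nonneg hB (s + a • t)
    simp only [map_add, map_smul, inner_add_left, inner_add_right,
      real_inner_smul_left, real_inner_smul_right] at h0
    rw [inner_toEuclideanLin_symm hB t s] at h0
    simp only [blockNorm_sq hB]
    linarith
  have hd := discrim_le_zero key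
  unfold discrim at hd
  refine abs_le_of_sq_le_sq' ?_ (mul_nonneg (blockNorm_nonneg s) (blockNorm_nonneg t)) |>.2
  nlinarith

theorem toEuclideanLin_inv_apply (hB : B.PosDef) (t : EuclideanSpace ℝ (Fin m)) :
    Matrix.toEuclideanLin B (Matrix.toEuclideanLin B⁻¹ t) = t := by
  have hu : IsUnit B.det := (Matrix.isUnit_iff_isUnit_det B).1 hB.isUnit
  simp [Matrix.toLpLin_apply, Matrix.mulVec_mulVec, Matrix.mul_nonsing_inv _ hu]

theorem inner_le_blockNorm_mul (hB : B.PosDef) (s t : EuclideanSpace ℝ (Fin m)) :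
    ⟪s, t⟫_ℝ ≤ blockNorm B s * blockNorm B (Matrix.toEuclideanLin B⁻¹ t) := by
  have := inner_toEuclideanLin_le hB (Matrix.toEuclideanLin B⁻¹ t) s
  rwa [toEuclideanLin_inv_apply hB, real_inner_comm, mul_comm] at this

/-- The duality inequality between a block norm and its conjugate. -/
theorem inner_le_dualBlockNorm_mul (hB : B.PosDef) (s t : EuclideanSpace ℝ (Fin m)) :
    ⟪s, t⟫_ℝ ≤ dualBlockNorm B t * blockNorm B s := by
  -- The real `sSup` is meaningful only on a set bounded above; the bound is the norm of `t` for the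
  -- inverse matrix.
  have hbdd : BddAbove {r : ℝ | ∃ s : EuclideanSpace ℝ (Fin m),
      blockNorm B s ≤ 1 ∧ r = ⟪s, t⟫_ℝ} := by
    refine ⟨blockNorm B (Matrix.toEuclideanLin B⁻¹ t), ?_⟩
    rintro r ⟨s, hs, rfl⟩
    refine (inner_le_blockNorm_mul hB s t).trans ?_
    exact mul_le_of_le_one_left (blockNorm_nonneg _) hs
  rcases (blockNorm_nonneg (B := B) s).eq_or_lt with h0 | h0
  · have := inner_le_blockNorm_mul hB s t
    rw [← h0] at this ⊢
    simpa using this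
  · have h1 : ⟪(blockNorm B s)⁻¹ • s, t⟫_ℝ ≤ dualBlockNorm B t := by
      refine le_csSup hbdd ⟨_, ?_, rfl⟩
      rw [blockNorm_smul, abs_of_pos (inv_pos.2 h0), inv_mul_cancel₀ h0.ne']
    rw [real_inner_smul_left] at h1
    calc ⟪s, t⟫_ℝ = (blockNorm B s)⁻¹ * ⟪s, t⟫_ℝ * blockNorm B s := by field_simp
      _ ≤ _ := by gcongr

end BlockNorm

/-! ### First order bounds for `f` -/

section Smooth

variable {n : ℕ} {d : Fin n → ℕ}

/-- The first order characterization of convexity. -/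
theorem add_inner_gradient_le {E : Type*} [NormedAddCommGroup E] [InnerProductSpace ℝ E]
    [CompleteSpace E] {f : E → ℝ} (hf : ConvexOn ℝ Set.univ f) (hd : Differentiable ℝ f)
    (x y : E) : f x + ⟪gradient f x, y - x⟫_ℝ ≤ f y := by
  have hg : HasDerivAt (fun u : ℝ => f (x + u • (y - x))) ⟪gradient f x, y - x⟫_ℝ 0 := by
    have h1 : HasDerivAt (fun u : ℝ => x + u • (y - x)) (y - x) 0 := by
      simpa using ((hasDerivAt_id (0 : ℝ)).smul_const (y - x)).const_add x
    have h2 : HasFDerivAt f (fderiv ℝ f x) (x + (0 : ℝ) • (y - x)) := by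
      simpa using (hd x).hasFDerivAt
    have h3 := h2.comp_hasDerivAt (0 : ℝ) h1
    rwa [inner_gradient_left]
  have hc : ConvexOn ℝ Set.univ (fun u : ℝ => f (x + u • (y - x))) := by
    refine ⟨convex_univ, fun u _ v _ a b ha hb hab => ?_⟩
    have := hf.2 (Set.mem_univ (x + u • (y - x))) (Set.mem_univ (x + v • (y - x))) ha hb hab
    convert this using 2
    rw [smul_add, smul_add, add_add_add_comm, ← add_smul, hab, one_smul]
    module
  have := hc.le_slope_of_hasDerivAt (Set.mem_univ 0) (Set.mem_univ 1) one_pos hg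
  simp only [slope_def_field, one_smul, zero_smul, add_zero, sub_zero, div_one,
    add_sub_cancel] at this
  linarith

theorem hasDerivAt_add_single {f : BlockSpace d → ℝ} (hd : Differentiable ℝ f) (x : BlockSpace d)
    (i : Fin n) (t : EuclideanSpace ℝ (Fin (d i))) (u : ℝ) :
    HasDerivAt (fun u : ℝ => f (x + PiLp.single 2 i (u • t)))
      ⟪blockGradient f i (x + PiLp.single 2 i (u • t)), t⟫_ℝ u := by
  have h1 : HasDerivAt (fun u : ℝ => x + u • (PiLp.single 2 i t : BlockSpace d))
      (PiLp.single 2 i t) u := by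
    simpa using ((hasDerivAt_id u).smul_const (PiLp.single 2 i t : BlockSpace d)).const_add x
  have h2 := ((hd _).hasFDerivAt (x := x + u • (PiLp.single 2 i t : BlockSpace d))).comp_hasDerivAt
    u h1
  have h3 : ∀ u : ℝ, (PiLp.single 2 i (u • t) : BlockSpace d) = u • PiLp.single 2 i t := by
    intro u
    ext j
    by_cases hj : j = i
    · subst hj; simp
    · simp [hj]
  simp only [h3]
  refine h2.congr_deriv ?_
  rw [← inner_gradient_left, PiLp.inner_apply, Finset.sum_eq_single i]
  · simp [blockGradient]
  · intro j _ hj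
    simp [hj]
  · simp

variable {B : ∀ i, Matrix (Fin (d i)) (Fin (d i)) ℝ} {𝒥 : Finset (Finset (Fin n))}
  {fJ : Finset (Fin n) → BlockSpace d → ℝ} {L : Fin n → ℝ} {f : BlockSpace d → ℝ}

theorem SmoothPartiallySeparable.convexOn (hf : SmoothPartiallySeparable B 𝒥 fJ L f) :
    ConvexOn ℝ Set.univ f := by
  have : f = fun x => ∑ J ∈ 𝒥, fJ J x := funext hf.sum_eq
  rw [this]
  refine ⟨convex_univ, fun x hx y hy a b ha hb hab => ?_⟩
  simp only [smul_eq_mul, Finset.mul_sum, ← Finset.sum_add_distrib]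
  exact Finset.sum_le_sum fun J hJ => (hf.convex J hJ).2 hx hy ha hb hab

/-- The quadratic upper bound along one block given by the block Lipschitz gradient. -/
theorem SmoothPartiallySeparable.le_add_single (hB : ∀ i, (B i).PosDef)
    (hf : SmoothPartiallySeparable B 𝒥 fJ L f) (x : BlockSpace d) (i : Fin n)
    (t : EuclideanSpace ℝ (Fin (d i))) :
    f (x + PiLp.single 2 i t) ≤
      f x + ⟪blockGradient f i x, t⟫_ℝ + L i / 2 * blockNorm (B i) t ^ 2 := by
  set N := blockNorm (B i) t ^ 2 with hN
  -- `G` compares `f` along the segment with its quadratic model. The Lipschitz bound makes its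
  -- derivative nonpositive for `u ≥ 0`, and the claim is `G 1 ≤ G 0`.
  let G : ℝ → ℝ := fun u =>
    f (x + PiLp.single 2 i (u • t)) - u * ⟪blockGradient f i x, t⟫_ℝ - u ^ 2 * (L i / 2 * N)
  have hG : ∀ u, HasDerivAt G (⟪blockGradient f i (x + PiLp.single 2 i (u • t)), t⟫_ℝ
      - ⟪blockGradient f i x, t⟫_ℝ - u * (L i * N)) u := by
    intro u
    have := ((hasDerivAt_add_single hf.differentiable x i t u).sub
      ((hasDerivAt_id u).mul_const ⟪blockGradient f i x, t⟫_ℝ)).sub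
      ((hasDerivAt_pow 2 u).mul_const (L i / 2 * N))
    refine this.congr_deriv ?_
    simp
    ring
  have hle : ∀ u : ℝ, 0 ≤ u → ⟪blockGradient f i (x + PiLp.single 2 i (u • t)), t⟫_ℝ
      - ⟪blockGradient f i x, t⟫_ℝ - u * (L i * N) ≤ 0 := by
    intro u hu
    have h1 := inner_le_dualBlockNorm_mul (hB i) t
      (blockGradient f i (x + PiLp.single 2 i (u • t)) - blockGradient f i x)
    have h2 := hf.lipschitz x i (u • t)
    rw [blockNorm_smul, abs_of_nonneg hu] at h2
    have h3 := mul_le_mul_of_nonneg_right h2 (blockNorm_nonneg (B := B i) t)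
    rw [real_inner_comm, inner_sub_left] at h1
    rw [hN]
    nlinarith
  have hanti : AntitoneOn G (Set.Icc 0 1) := by
    refine antitoneOn_of_deriv_nonpos (convex_Icc 0 1)
      (fun u _ => (hG u).continuousAt.continuousWithinAt)
      (fun u _ => (hG u).differentiableAt.differentiableWithinAt) ?_
    intro u hu
    rw [(hG u).deriv]
    rw [interior_Icc] at hu
    exact hle u hu.1.le
  have := hanti (by simp : (0 : ℝ) ∈ Set.Icc (0 : ℝ) 1) (by simp : (1 : ℝ) ∈ Set.Icc (0 : ℝ) 1)
    zero_le_one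
  have h0 : (PiLp.single 2 i (0 : EuclideanSpace ℝ (Fin (d i))) : BlockSpace d) = 0 := by
    ext j
    by_cases hj : j = i
    · subst hj; simp
    · simp [hj]
  simp only [G, one_smul, zero_smul, h0, add_zero] at this
  linarith

end Smooth

end DBCD

/-! ### Counting samplings by symmetry -/

noncomputable section

namespace DBCD

variable {n C s τ : ℕ} {P : Fin C → Finset (Fin n)}

/-- The sets that have exactly `τ` elements in every part `P c`. -/
def samplings (P : Fin C → Finset (Fin n)) (τ : ℕ) : Finset (Finset (Fin n)) :=
  Finset.univ.filter fun Z => ∀ c, (P c ∩ Z).card = τ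

theorem mem_samplings {Z : Finset (Fin n)} : Z ∈ samplings P τ ↔ ∀ c, (P c ∩ Z).card = τ := by
  simp [samplings]

theorem BalancedPartition.eq_of_mem (hP : BalancedPartition P s) {a : Fin n} {c c' : Fin C}
    (h : a ∈ P c) (h' : a ∈ P c') : c = c' := by
  by_contra hne
  exact Finset.disjoint_left.1 (hP.disjoint c c' hne) h h'

/-- The permutation `σ` of the blocks permutes the parts `P c`. -/
def PermutesParts (P : Fin C → Finset (Fin n)) (σ : Equiv.Perm (Fin n)) : Prop :=
  ∃ π : Equiv.Perm (Fin C), ∀ a c, σ a ∈ P (π c) ↔ a ∈ P c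

theorem mem_map_of_apply_eq {σ : Equiv.Perm (Fin n)} {a b : Fin n} (h : σ a = b)
    {Z : Finset (Fin n)} : b ∈ Z.map σ.toEmbedding ↔ a ∈ Z := by
  subst h
  exact Finset.mem_map' σ.toEmbedding

theorem PermutesParts.map_mem_samplings {σ : Equiv.Perm (Fin n)} (hσ : PermutesParts P σ)
    (Z : Finset (Fin n)) : Z.map σ.toEmbedding ∈ samplings P τ ↔ Z ∈ samplings P τ := by
  obtain ⟨π, hπ⟩ := hσ
  rw [mem_samplings, mem_samplings, ← π.forall_congr_right]
  refine forall_congr' fun c => ?_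
  have : P (π c) ∩ Z.map σ.toEmbedding = (P c ∩ Z).map σ.toEmbedding := by
    ext b
    obtain ⟨a, rfl⟩ := σ.surjective b
    simp [hπ]
  rw [this, Finset.card_map]

/-- Permutations that respect the parts act on the samplings. All symmetry arguments for the counts
below go through this bijection. -/
theorem PermutesParts.card_filter_samplings {σ : Equiv.Perm (Fin n)} (hσ : PermutesParts P σ)
    {p q : Finset (Fin n) → Prop} [DecidablePred p] [DecidablePred q]
    (hpq : ∀ Z, q (Z.map σ.toEmbedding) ↔ p Z) :
    ((samplings P τ).filter p).card = ((samplings P τ).filter q).card := by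
  refine Finset.card_equiv (Equiv.finsetCongr σ) fun Z => ?_
  simp only [Finset.mem_filter, Equiv.finsetCongr_apply]
  rw [hσ.map_mem_samplings, hpq]

theorem BalancedPartition.permutesParts_swap (hP : BalancedPartition P s) {c : Fin C}
    {i j : Fin n} (hi : i ∈ P c) (hj : j ∈ P c) : PermutesParts P (Equiv.swap i j) := by
  refine ⟨1, fun a c' => ?_⟩
  have hij : i ∈ P c' ↔ j ∈ P c' :=
    ⟨fun h => hP.eq_of_mem hi h ▸ hj, fun h => hP.eq_of_mem hj h ▸ hi⟩
  rw [Equiv.Perm.one_apply]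
  rcases eq_or_ne a i with rfl | h1
  · rw [Equiv.swap_apply_left, hij]
  rcases eq_or_ne a j with rfl | h2
  · rw [Equiv.swap_apply_right, hij]
  · rw [Equiv.swap_apply_of_ne_of_ne h1 h2]

/-- Two sets with the same number `ξ` of elements in every part are exchanged by a permutation
of the blocks that permutes the parts; it can be chosen to map `i` to `j`. -/
theorem BalancedPartition.exists_perm (hP : BalancedPartition P s) {ξ : ℕ}
    {J J' : Finset (Fin n)} (hJ : ∀ c, (P c ∩ J).card = ξ) (hJ' : ∀ c, (P c ∩ J').card = ξ)
    {i j : Fin n} (hi : i ∈ J) (hj : j ∈ J') :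
    ∃ σ : Equiv.Perm (Fin n), PermutesParts P σ ∧ (∀ a, σ a ∈ J' ↔ a ∈ J) ∧ σ i = j := by
  classical
  choose part hpart using hP.cover
  have mem_iff : ∀ a c, a ∈ P c ↔ part a = c := fun a c =>
    ⟨fun h => hP.eq_of_mem (hpart a) h, fun h => h ▸ hpart a⟩
  -- The part of `i` must be sent to the part of `j`; the other parts can stay.
  set π : Equiv.Perm (Fin C) := Equiv.swap (part i) (part j) with hπ
  -- A permutation with `l' ∘ σ = l` moves the parts by `π` and maps `J` to `J'`. It exists because
  -- matching fibres of `l` and `l'` have the same size, `ξ` or `s - ξ`.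
  let l : Fin n → Fin C × Bool := fun a => (π (part a), decide (a ∈ J))
  let l' : Fin n → Fin C × Bool := fun a => (part a, decide (a ∈ J'))
  have card_sdiff : ∀ (K : Finset (Fin n)) (c : Fin C), (P c ∩ K).card = ξ →
      (P c \ K).card = s - ξ := by
    intro K c hK
    have := Finset.card_inter_add_card_sdiff (P c) K
    rw [hP.card_eq] at this
    omega
  have hfib : ∀ y, Nonempty ({a // l a = y} ≃ {a // l' a = y}) := by
    rintro ⟨c, b⟩
    refine Fintype.card_eq.1 ?_
    rw [Fintype.card_subtype, Fintype.card_subtype]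
    cases b
    · have h1 : (Finset.univ.filter fun a => l a = (c, false)) = P (π.symm c) \ J := by
        ext a; simp [l, mem_iff, Equiv.eq_symm_apply]
      have h2 : (Finset.univ.filter fun a => l' a = (c, false)) = P c \ J' := by
        ext a; simp [l', mem_iff]
      rw [h1, h2, card_sdiff _ _ (hJ _), card_sdiff _ _ (hJ' _)]
    · have h1 : (Finset.univ.filter fun a => l a = (c, true)) = P (π.symm c) ∩ J := by
        ext a; simp [l, mem_iff, Equiv.eq_symm_apply]
      have h2 : (Finset.univ.filter fun a => l' a = (c, true)) = P c ∩ J' := by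
        ext a; simp [l', mem_iff]
      rw [h1, h2, hJ, hJ']
  let σ₀ : Equiv.Perm (Fin n) := Equiv.ofFiberEquiv fun y => (hfib y).some
  have hσ₀ : ∀ a, l' (σ₀ a) = l a := fun a => Equiv.ofFiberEquiv_map _ a
  have hij : l' (σ₀ i) = l' j := by
    rw [hσ₀]
    simp [l, l', hi, hj, hπ]
  -- `σ₀ i` and `j` carry the same label, so exchanging them afterwards forces `i ↦ j` without
  -- disturbing the labels.
  have hσ : ∀ a, l' (Equiv.swap (σ₀ i) j (σ₀ a)) = l a := by
    intro a
    rw [← hσ₀]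
    rcases eq_or_ne (σ₀ a) (σ₀ i) with h1 | h1
    · rw [h1, Equiv.swap_apply_left, hij]
    rcases eq_or_ne (σ₀ a) j with h2 | h2
    · rw [h2, Equiv.swap_apply_right, hij]
    · rw [Equiv.swap_apply_of_ne_of_ne h1 h2]
  refine ⟨σ₀.trans (Equiv.swap (σ₀ i) j), ⟨π, fun a c => ?_⟩, fun a => ?_, ?_⟩
  · have := congrArg Prod.fst (hσ a)
    simp only [l, l'] at this
    rw [mem_iff, mem_iff, Equiv.trans_apply, this, π.apply_eq_iff_eq]
  · have := congrArg Prod.snd (hσ a)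
    simpa [l, l'] using this
  · simp

/-- The number of samplings `Z ∋ i` with `|J ∩ Z| = k` is the same for all sets `J` with `ξ`
elements in every part, and all `i ∈ J`. -/
theorem BalancedPartition.card_filter_mem_card_inter_eq (hP : BalancedPartition P s) {ξ : ℕ}
    {J J' : Finset (Fin n)} (hJ : ∀ c, (P c ∩ J).card = ξ) (hJ' : ∀ c, (P c ∩ J').card = ξ)
    {i j : Fin n} (hi : i ∈ J) (hj : j ∈ J') (k : ℕ) :
    ((samplings P τ).filter fun Z => i ∈ Z ∧ (J ∩ Z).card = k).card =
      ((samplings P τ).filter fun Z => j ∈ Z ∧ (J' ∩ Z).card = k).card := by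
  obtain ⟨σ, hσ, hσJ, rfl⟩ := hP.exists_perm hJ hJ' hi hj
  refine hσ.card_filter_samplings fun Z => ?_
  have : J' ∩ Z.map σ.toEmbedding = (J ∩ Z).map σ.toEmbedding := by
    ext b
    obtain ⟨a, rfl⟩ := σ.surjective b
    simp [hσJ]
  rw [this, Finset.card_map]
  rw [mem_map_of_apply_eq rfl]

theorem sum_card_filter_mem (Zs : Finset (Finset (Fin n))) (A : Finset (Fin n)) :
    ∑ j ∈ A, (Zs.filter fun Z => j ∈ Z).card = ∑ Z ∈ Zs, (A ∩ Z).card := by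
  simp only [Finset.card_filter]
  rw [Finset.sum_comm]
  refine Finset.sum_congr rfl fun Z _ => ?_
  rw [← Finset.card_filter]
  congr 1

/-- All blocks of a part lie in equally many samplings, by swapping; double counting the pairs `j ∈
P c ∩ Z` then fixes the number. -/
theorem BalancedPartition.card_filter_mem (hP : BalancedPartition P s) (i : Fin n) :
    s * ((samplings P τ).filter fun Z => i ∈ Z).card = τ * (samplings P τ).card := by
  obtain ⟨c, hc⟩ := hP.cover i
  have h1 : ∀ j ∈ P c, ((samplings P τ).filter fun Z => j ∈ Z).card =
      ((samplings P τ).filter fun Z => i ∈ Z).card := fun j hj =>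
    (hP.permutesParts_swap hj hc).card_filter_samplings fun Z => by
      rw [mem_map_of_apply_eq (Equiv.swap_apply_left j i)]
  have h2 := sum_card_filter_mem (samplings P τ) (P c)
  rw [Finset.sum_congr rfl h1, Finset.sum_const, hP.card_eq,
    Finset.sum_congr rfl fun Z hZ => mem_samplings.1 hZ c, Finset.sum_const] at h2
  simpa [mul_comm] using h2

/-- The same double count among the samplings containing `i`: swaps inside the other part leave `i`
fixed. -/
theorem BalancedPartition.card_filter_mem_mem_of_ne (hP : BalancedPartition P s) {c c' : Fin C}
    {i j : Fin n} (hi : i ∈ P c) (hj : j ∈ P c') (hne : c ≠ c') :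
    s * ((samplings P τ).filter fun Z => i ∈ Z ∧ j ∈ Z).card =
      τ * ((samplings P τ).filter fun Z => i ∈ Z).card := by
  have hi' : ∀ a ∈ P c', i ≠ a := fun a ha h => hne (hP.eq_of_mem hi (h ▸ ha))
  have h1 : ∀ a ∈ P c', (((samplings P τ).filter fun Z => i ∈ Z).filter fun Z => a ∈ Z).card =
      ((samplings P τ).filter fun Z => i ∈ Z ∧ j ∈ Z).card := fun a ha => by
    rw [Finset.filter_filter]
    refine (hP.permutesParts_swap ha hj).card_filter_samplings fun Z => ?_
    have e1 : Equiv.swap a j i = i := Equiv.swap_apply_of_ne_of_ne (hi' a ha) (hi' j hj)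
    rw [mem_map_of_apply_eq e1, mem_map_of_apply_eq (Equiv.swap_apply_left a j)]
  have h2 := sum_card_filter_mem ((samplings P τ).filter fun Z => i ∈ Z) (P c')
  rw [Finset.sum_congr rfl h1, Finset.sum_const, hP.card_eq,
    Finset.sum_congr rfl fun Z hZ => mem_samplings.1 (Finset.mem_filter.1 hZ).1 c',
    Finset.sum_const] at h2
  simpa [mul_comm] using h2

/-- Within the part of `i`, the double count runs over the `s - 1` other blocks, of which a sampling
containing `i` picks `τ - 1`. -/
theorem BalancedPartition.card_filter_mem_mem (hP : BalancedPartition P s) {c : Fin C}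
    {i j : Fin n} (hi : i ∈ P c) (hj : j ∈ P c) (hne : i ≠ j) :
    (s - 1) * ((samplings P τ).filter fun Z => i ∈ Z ∧ j ∈ Z).card =
      (τ - 1) * ((samplings P τ).filter fun Z => i ∈ Z).card := by
  have h1 : ∀ a ∈ (P c).erase i,
      (((samplings P τ).filter fun Z => i ∈ Z).filter fun Z => a ∈ Z).card =
      ((samplings P τ).filter fun Z => i ∈ Z ∧ j ∈ Z).card := fun a ha => by
    rw [Finset.filter_filter]
    rw [Finset.mem_erase] at ha
    refine (hP.permutesParts_swap ha.2 hj).card_filter_samplings fun Z => ?_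
    have e1 : Equiv.swap a j i = i := Equiv.swap_apply_of_ne_of_ne ha.1.symm hne
    rw [mem_map_of_apply_eq e1, mem_map_of_apply_eq (Equiv.swap_apply_left a j)]
  have h2 := sum_card_filter_mem ((samplings P τ).filter fun Z => i ∈ Z) ((P c).erase i)
  have h3 : ∀ Z ∈ (samplings P τ).filter fun Z => i ∈ Z, ((P c).erase i ∩ Z).card = τ - 1 := by
    intro Z hZ
    rw [Finset.mem_filter] at hZ
    rw [← mem_samplings.1 hZ.1 c, ← Finset.card_erase_of_mem (Finset.mem_inter.2 ⟨hi, hZ.2⟩)]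
    rw [Finset.erase_inter]
  rw [Finset.sum_congr rfl h1, Finset.sum_const, Finset.card_erase_of_mem hi, hP.card_eq,
    Finset.sum_congr rfl h3, Finset.sum_const] at h2
  simpa [mul_comm] using h2

/-- The probability `τ / s` that a block is sampled. -/
theorem BalancedPartition.cast_card_filter_mem (hP : BalancedPartition P s) (hs : 0 < s)
    (i : Fin n) : (((samplings P τ).filter fun Z => i ∈ Z).card : ℝ) =
      τ / s * (samplings P τ).card := by
  have : (s : ℝ) * ((samplings P τ).filter fun Z => i ∈ Z).card = τ * (samplings P τ).card := by
    exact_mod_cast hP.card_filter_mem i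
  have hs' : (s : ℝ) ≠ 0 := by positivity
  field_simp
  linarith

/-- The sum of `|J ∩ Z|` over the samplings `Z ∋ i`, where `i ∈ J` and `J` has `ξ` elements in
every part. -/
theorem BalancedPartition.sum_filter_mem_card_inter (hP : BalancedPartition P s) (hs : 0 < s)
    (hτ : 1 ≤ τ) {ξ : ℕ} {J : Finset (Fin n)} (hJ : ∀ c, (P c ∩ J).card = ξ) {i : Fin n}
    (hi : i ∈ J) :
    ∑ Z ∈ (samplings P τ).filter (fun Z => i ∈ Z), ((J ∩ Z).card : ℝ) =
      τ / s * (samplings P τ).card * stepBeta C s τ ξ := by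
  obtain ⟨c, hc⟩ := hP.cover i
  set N : ℝ := (((samplings P τ).filter fun Z => i ∈ Z).card : ℝ) with hN
  let M : Fin n → ℝ := fun j => ((samplings P τ).filter fun Z => i ∈ Z ∧ j ∈ Z).card
  have hs' : (0 : ℝ) < s := by exact_mod_cast hs
  have hsum : ∑ Z ∈ (samplings P τ).filter (fun Z => i ∈ Z), ((J ∩ Z).card : ℝ) =
      ∑ j ∈ J, M j := by
    have := sum_card_filter_mem ((samplings P τ).filter fun Z => i ∈ Z) J
    simp only [Finset.filter_filter] at this
    simp only [M]
    exact_mod_cast this.symm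
  have hdec : ∑ j ∈ J, M j = ∑ c', ∑ j ∈ P c' ∩ J, M j := by
    rw [← Finset.sum_biUnion]
    · refine Finset.sum_congr ?_ fun _ _ => rfl
      ext a
      simp only [Finset.mem_biUnion, Finset.mem_univ, true_and, Finset.mem_inter]
      exact ⟨fun h => (hP.cover a).imp fun c hc => ⟨hc, h⟩, fun ⟨_, h⟩ => h.2⟩
    · intro c₁ _ c₂ _ hne
      exact (hP.disjoint c₁ c₂ hne).mono Finset.inter_subset_left Finset.inter_subset_left
  have hother : ∀ c' ∈ Finset.univ.erase c, ∑ j ∈ P c' ∩ J, M j = N * (ξ * τ / s) := by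
    intro c' hc'
    have hne : c ≠ c' := (Finset.ne_of_mem_erase hc').symm
    have : ∀ j ∈ P c' ∩ J, M j = N * (τ / s) := by
      intro j hj
      have h1 : (s : ℝ) * M j = τ * N := by
        simp only [M, hN]
        exact_mod_cast hP.card_filter_mem_mem_of_ne (τ := τ) hc (Finset.mem_inter.1 hj).1 hne
      field_simp
      linarith
    rw [Finset.sum_congr rfl this, Finset.sum_const, hJ, nsmul_eq_mul]
    ring
  have hsame : ∑ j ∈ P c ∩ J, M j =
      N * (1 + ((ξ : ℝ) - 1) * ((τ : ℝ) - 1) / max 1 ((s : ℝ) - 1)) := by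
    have hic : i ∈ P c ∩ J := Finset.mem_inter.2 ⟨hc, hi⟩
    have hpair : ∀ j ∈ (P c ∩ J).erase i,
        M j = N * (((τ : ℝ) - 1) / max 1 ((s : ℝ) - 1)) := by
      intro j hj
      rw [Finset.mem_erase, Finset.mem_inter] at hj
      -- Two distinct blocks in one part exclude `s = 1`, so the maximum in `β` is `s - 1` whenever
      -- a pair has to be counted.
      have hs2 : 2 ≤ s := by
        rw [← hP.card_eq c]
        exact Finset.one_lt_card.2 ⟨i, hc, j, hj.2.1, hj.1.symm⟩
      have hs2' : (2 : ℝ) ≤ s := by exact_mod_cast hs2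
      have h1 : (((s - 1 : ℕ) : ℝ)) * M j = ((τ - 1 : ℕ) : ℝ) * N := by
        simp only [M, hN]
        exact_mod_cast hP.card_filter_mem_mem (τ := τ) hc hj.2.1 hj.1.symm
      rw [Nat.cast_sub (by omega), Nat.cast_sub hτ, Nat.cast_one] at h1
      rw [max_eq_right (by linarith)]
      have : (s : ℝ) - 1 ≠ 0 := by linarith
      field_simp
      linarith
    have hξ : 1 ≤ ξ := by
      rw [← hJ c]
      exact Finset.card_pos.2 ⟨i, hic⟩
    have hMi : M i = N := by simp [M, hN]
    rw [← Finset.add_sum_erase _ _ hic, Finset.sum_congr rfl hpair, Finset.sum_const,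
      Finset.card_erase_of_mem hic, hJ, nsmul_eq_mul, Nat.cast_sub hξ, hMi, Nat.cast_one]
    ring
  have hC : 1 ≤ C := by have := c.2; omega
  rw [hsum, hdec, ← Finset.add_sum_erase _ _ (Finset.mem_univ c), Finset.sum_congr rfl hother,
    Finset.sum_const, Finset.card_erase_of_mem (Finset.mem_univ c), hsame, Finset.card_univ,
    Fintype.card_fin, nsmul_eq_mul, Nat.cast_sub hC, ← hP.cast_card_filter_mem hs i, stepBeta,
    Nat.cast_one, ← hN]
  ring

/-- Padding makes all the sets `J` alike for the symmetry argument. It is harmless because `f_J`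
ignores the added blocks. -/
theorem BalancedPartition.exists_superset (hP : BalancedPartition P s) {ξ : ℕ}
    {J : Finset (Fin n)} (hJ : ∀ c, (P c ∩ J).card ≤ ξ) (hξ : ξ ≤ s) :
    ∃ J', J ⊆ J' ∧ ∀ c, (P c ∩ J').card = ξ := by
  have : ∀ c, ∃ K, P c ∩ J ⊆ K ∧ K ⊆ P c ∧ K.card = ξ := fun c =>
    Finset.exists_subsuperset_card_eq Finset.inter_subset_left (hJ c) (by rwa [hP.card_eq])
  choose K hJK hKP hK using this
  refine ⟨Finset.univ.biUnion K, fun a ha => ?_, fun c => ?_⟩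
  · obtain ⟨c, hc⟩ := hP.cover a
    exact Finset.mem_biUnion.2 ⟨c, Finset.mem_univ c, hJK c (Finset.mem_inter.2 ⟨hc, ha⟩)⟩
  · rw [← hK c]
    congr 1
    ext a
    simp only [Finset.mem_inter, Finset.mem_biUnion, Finset.mem_univ, true_and]
    refine ⟨fun ⟨h1, c', h2⟩ => hP.eq_of_mem h1 (hKP c' h2) ▸ h2, fun h => ⟨hKP c h, c, h⟩⟩

/-- The mean of a quantity that sees one block only: new value with probability `τ / s`, old value
otherwise. This handles both `Ω` and the weighted norm. -/
theorem sum_samplings_ite (hP : BalancedPartition P s) (hs : 0 < s) (i : Fin n) (a b : ℝ) :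
    ∑ Z ∈ samplings P τ, (if i ∈ Z then b else a) =
      (samplings P τ).card * ((1 - τ / s) * a + τ / s * b) := by
  have h1 := hP.cast_card_filter_mem (τ := τ) hs i
  have h2 := Finset.card_filter_add_card_filter_not (s := samplings P τ) (fun Z => i ∈ Z)
  have h3 : (((samplings P τ).filter fun Z => i ∉ Z).card : ℝ) =
      (samplings P τ).card - τ / s * (samplings P τ).card := by
    rw [← h1, ← h2]
    push_cast
    ring
  rw [Finset.sum_ite, Finset.sum_const, Finset.sum_const, nsmul_eq_mul, nsmul_eq_mul, h1, h3]
  ring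

/-- The samplings are the unions of `τ`-element subsets of the parts. -/
theorem BalancedPartition.sum_piFinset (hP : BalancedPartition P s) {M : Type*}
    [AddCommMonoid M] (G : Finset (Fin n) → M) :
    ∑ z ∈ Fintype.piFinset (fun c => Finset.powersetCard τ (P c)),
      G (Finset.univ.biUnion z) = ∑ Z ∈ samplings P τ, G Z := by
  have hinter : ∀ z ∈ Fintype.piFinset (fun c => Finset.powersetCard τ (P c)), ∀ c,
      P c ∩ Finset.univ.biUnion z = z c := by
    intro z hz c
    rw [Fintype.mem_piFinset] at hz
    have hz' := fun c => (Finset.mem_powersetCard.1 (hz c)).1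
    ext a
    simp only [Finset.mem_inter, Finset.mem_biUnion, Finset.mem_univ, true_and]
    exact ⟨fun ⟨h1, c', h2⟩ => hP.eq_of_mem h1 (hz' c' h2) ▸ h2, fun h => ⟨hz' c h, c, h⟩⟩
  refine Finset.sum_bij' (fun z _ => Finset.univ.biUnion z) (fun Z _ c => P c ∩ Z) ?_ ?_ ?_ ?_ ?_
  · intro z hz
    refine mem_samplings.2 fun c => ?_
    rw [hinter z hz]
    exact (Finset.mem_powersetCard.1 (Fintype.mem_piFinset.1 hz c)).2
  · intro Z hZ
    rw [Fintype.mem_piFinset]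
    exact fun c => Finset.mem_powersetCard.2 ⟨Finset.inter_subset_left, mem_samplings.1 hZ c⟩
  · intro z hz
    funext c
    exact hinter z hz c
  · intro Z _
    ext a
    simp only [Finset.mem_biUnion, Finset.mem_univ, true_and, Finset.mem_inter]
    exact ⟨fun ⟨_, h⟩ => h.2, fun h => (hP.cover a).imp fun c hc => ⟨hc, h⟩⟩
  · intros
    rfl

end DBCD

end

/-! ### The expected separable overapproximation -/

noncomputable section

namespace DBCD

variable {n C s τ : ℕ} {P : Fin C → Finset (Fin n)} {d : Fin n → ℕ}

theorem sum_single_apply (t : ∀ i, EuclideanSpace ℝ (Fin (d i))) (Z : Finset (Fin n))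
    (j : Fin n) :
    (∑ i ∈ Z, PiLp.single 2 i (t i) : BlockSpace d) j = if j ∈ Z then t j else 0 := by
  rw [WithLp.ofLp_sum, Finset.sum_apply]
  split_ifs with hj
  · rw [Finset.sum_eq_single j (fun i _ hi => by simp [hi.symm]) (fun h => absurd hj h)]
    simp
  · refine Finset.sum_eq_zero fun i hi => ?_
    have : j ≠ i := fun h => hj (h ▸ hi)
    simp [this]

theorem sum_filter_mem_eq_sum_card (Zs : Finset (Finset (Fin n))) (J : Finset (Fin n))
    (i : Fin n) (ψ : ℕ → ℝ) :
    ∑ Z ∈ Zs.filter (fun Z => i ∈ Z), ψ (J ∩ Z).card =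
      ∑ k ∈ Finset.range (n + 1),
        ((Zs.filter fun Z => i ∈ Z ∧ (J ∩ Z).card = k).card : ℝ) * ψ k := by
  rw [← Finset.sum_fiberwise_of_maps_to (g := fun Z => (J ∩ Z).card)
    (t := Finset.range (n + 1))]
  · refine Finset.sum_congr rfl fun k _ => ?_
    rw [Finset.filter_filter, Finset.sum_congr rfl (g := fun _ => ψ k), Finset.sum_const,
      nsmul_eq_mul]
    intro Z hZ
    rw [(Finset.mem_filter.1 hZ).2.2]
  · intro Z _
    rw [Finset.mem_range, Nat.lt_succ_iff]
    simpa using Finset.card_le_univ (J ∩ Z)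

/-- `Σ_Z Σ_{i ∈ J ∩ Z} ψ(|J ∩ Z|, i)`, organized by `i` and `k = |J ∩ Z|`. -/
theorem sum_sum_inter (Zs : Finset (Finset (Fin n))) (J : Finset (Fin n)) (ψ : ℕ → Fin n → ℝ) :
    ∑ Z ∈ Zs, ∑ i ∈ J ∩ Z, ψ (J ∩ Z).card i =
      ∑ i ∈ J, ∑ k ∈ Finset.range (n + 1),
        ((Zs.filter fun Z => i ∈ Z ∧ (J ∩ Z).card = k).card : ℝ) * ψ k i := by
  have h1 : ∀ Z ∈ Zs, ∑ i ∈ J ∩ Z, ψ (J ∩ Z).card i =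
      ∑ i ∈ J, if i ∈ Z then ψ (J ∩ Z).card i else 0 := by
    intro Z _
    rw [← Finset.sum_filter, Finset.filter_mem_eq_inter]
  rw [Finset.sum_congr rfl h1, Finset.sum_comm]
  refine Finset.sum_congr rfl fun i _ => ?_
  rw [← Finset.sum_filter]
  exact sum_filter_mem_eq_sum_card Zs J i fun k => ψ k i

/-- A convex function of the blocks in `J` at a joint step in the blocks `Z` is at most the average
over `J ∩ Z` of its values at single block steps that are `|J ∩ Z|` times as long. -/
theorem convex_joint_step_le {g : BlockSpace d → ℝ} (hg : ConvexOn ℝ Set.univ g)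
    {J J' : Finset (Fin n)} (hJ : J ⊆ J')
    (hdep : ∀ x y : BlockSpace d, (∀ i ∈ J, x i = y i) → g x = g y)
    (x : BlockSpace d) (t : ∀ i, EuclideanSpace ℝ (Fin (d i))) (Z : Finset (Fin n)) :
    g (x + ∑ i ∈ Z, PiLp.single 2 i (t i)) - g x ≤
      ∑ i ∈ J' ∩ Z, ((J' ∩ Z).card : ℝ)⁻¹ *
        (g (x + PiLp.single 2 i (((J' ∩ Z).card : ℝ) • t i)) - g x) := by
  set A := J' ∩ Z with hA
  -- Since `J ⊆ J'`, the steps in `Z` and in `J' ∩ Z` agree on `J`, which is all that `g` sees.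
  have hdep' : ∀ y : BlockSpace d, (∀ j ∈ J, y j = if j ∈ A then t j else 0) →
      g (x + ∑ i ∈ Z, PiLp.single 2 i (t i)) = g (x + y) := by
    intro y hy
    refine hdep _ _ fun j hj => ?_
    rw [PiLp.add_apply, PiLp.add_apply, sum_single_apply, hy j hj]
    simp [hA, hJ hj]
  rcases A.eq_empty_or_nonempty with h0 | h0
  · rw [hdep' 0 (by simp [h0]), h0]
    simp
  have hK : (A.card : ℝ) ≠ 0 := by exact_mod_cast (Finset.card_pos.2 h0).ne'
  have h1 : ∑ _i ∈ A, (A.card : ℝ)⁻¹ = 1 := by simp [hK]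
  have h2 := hg.map_sum_le (t := A) (w := fun _ => (A.card : ℝ)⁻¹)
    (p := fun i => x + PiLp.single 2 i ((A.card : ℝ) • t i)) (fun _ _ => by positivity) h1
    (fun _ _ => Set.mem_univ _)
  have h3 : ∑ i ∈ A, (A.card : ℝ)⁻¹ • (x + PiLp.single 2 i ((A.card : ℝ) • t i)) =
      x + ∑ i ∈ A, (A.card : ℝ)⁻¹ • (PiLp.single 2 i ((A.card : ℝ) • t i) : BlockSpace d) := by
    simp only [smul_add, Finset.sum_add_distrib]
    rw [← Finset.sum_smul, h1, one_smul]
  rw [h3, ← hdep'] at h2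
  · simp only [smul_eq_mul] at h2
    simp only [mul_sub, Finset.sum_sub_distrib]
    rw [← Finset.sum_mul, h1, one_mul]
    linarith
  · intro j _
    have h4 : ∀ i, (A.card : ℝ)⁻¹ • (PiLp.single 2 i ((A.card : ℝ) • t i) : BlockSpace d) =
        PiLp.single 2 i (t i) := by
      intro i
      ext j
      by_cases hji : j = i
      · subst hji
        simp [hK]
      · simp [hji]
    simp only [h4]
    exact sum_single_apply t A j

theorem BalancedPartition.xi_le (hP : BalancedPartition P s) (𝒥 : Finset (Finset (Fin n))) :
    xi P 𝒥 ≤ s :=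
  Finset.sup_le fun q _ => by
    rw [← hP.card_eq q.1]
    exact Finset.card_le_card Finset.inter_subset_left

theorem card_inter_le_xi {𝒥 : Finset (Finset (Fin n))} {J : Finset (Fin n)} (hJ : J ∈ 𝒥)
    (c : Fin C) : (P c ∩ J).card ≤ xi P 𝒥 :=
  Finset.le_sup (f := fun q : Fin C × Finset (Fin n) => (P q.1 ∩ q.2).card)
    (b := (c, J)) (Finset.mem_product.2 ⟨Finset.mem_univ c, hJ⟩)

/-- Only `ξ = 0` makes the middle term negative, and then `τ - 1 ≤ s - 1` keeps it at least `-1`. -/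
theorem stepBeta_nonneg (hC : 0 < C) (hτ : 1 ≤ τ) (hτs : τ ≤ s) (ξ : ℕ) :
    0 ≤ stepBeta C s τ ξ := by
  have hC' : (1 : ℝ) ≤ C := by exact_mod_cast hC
  have hτ' : (1 : ℝ) ≤ τ := by exact_mod_cast hτ
  have hτs' : (τ : ℝ) ≤ s := by exact_mod_cast hτs
  have h1 : (0 : ℝ) ≤ ((C : ℝ) - 1) * ((ξ : ℝ) * τ / s) :=
    mul_nonneg (by linarith) (by positivity)
  have hm : (0 : ℝ) < max 1 ((s : ℝ) - 1) := lt_max_of_lt_left one_pos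
  have h2 : -1 ≤ ((ξ : ℝ) - 1) * ((τ : ℝ) - 1) / max 1 ((s : ℝ) - 1) := by
    rw [le_div_iff₀ hm]
    have : (s : ℝ) - 1 ≤ max 1 ((s : ℝ) - 1) := le_max_right _ _
    have hξ : (0 : ℝ) ≤ ξ := by positivity
    nlinarith [mul_nonneg hξ (sub_nonneg.2 hτ')]
  unfold stepBeta
  linarith

variable {B : ∀ i, Matrix (Fin (d i)) (Fin (d i)) ℝ} {𝒥 : Finset (Finset (Fin n))}
  {fJ : Finset (Fin n) → BlockSpace d → ℝ} {L : Fin n → ℝ} {f : BlockSpace d → ℝ}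

/-- The parts cover all blocks, so every `J ∈ 𝒥` is empty and every `f_J` is constant. -/
theorem SmoothPartiallySeparable.eq_of_xi_eq_zero (hP : BalancedPartition P s)
    (hf : SmoothPartiallySeparable B 𝒥 fJ L f) (hξ : xi P 𝒥 = 0) (x y : BlockSpace d) :
    f x = f y := by
  rw [hf.sum_eq, hf.sum_eq]
  refine Finset.sum_congr rfl fun J hJ => hf.depends J hJ x y fun i hi => ?_
  obtain ⟨c, hc⟩ := hP.cover i
  have h1 := card_inter_le_xi (P := P) hJ c
  rw [hξ, Nat.le_zero, Finset.card_eq_zero] at h1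
  exact absurd (Finset.mem_inter.2 ⟨hc, hi⟩) (h1 ▸ Finset.notMem_empty i)

/-- The expected separable overapproximation of `f` for the distributed sampling. -/
theorem SmoothPartiallySeparable.sum_samplings_le (hB : ∀ i, (B i).PosDef)
    (hf : SmoothPartiallySeparable B 𝒥 fJ L f) (hC : 0 < C) (hP : BalancedPartition P s)
    (hτ : 1 ≤ τ) (hτs : τ ≤ s) (x : BlockSpace d) (t : ∀ i, EuclideanSpace ℝ (Fin (d i))) :
    ∑ Z ∈ samplings P τ, f (x + ∑ i ∈ Z, PiLp.single 2 i (t i)) ≤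
      (samplings P τ).card * (f x + τ / s * ∑ i, (⟪blockGradient f i x, t i⟫_ℝ
        + stepBeta C s τ (xi P 𝒥) * L i / 2 * blockNorm (B i) (t i) ^ 2)) := by
  have hs : 0 < s := by omega
  set ξ := xi P 𝒥 with hξdef
  -- For `ξ = 0` no reference block `i₀` exists; `f` is constant and nonnegativity of `β` suffices.
  rcases Nat.eq_zero_or_pos ξ with hξ | hξ
  · have hconst : ∀ y, f y = f x := fun y => hf.eq_of_xi_eq_zero hP hξ y x
    have hgrad : ∀ i, blockGradient f i x = 0 := by
      intro i
      have : f = fun _ => f x := funext hconst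
      rw [blockGradient, this, gradient_fun_const]
      rfl
    simp only [hconst, hgrad, inner_zero_left, zero_add, Finset.sum_const, nsmul_eq_mul]
    refine mul_le_mul_of_nonneg_left (le_add_of_nonneg_right ?_) (by positivity)
    refine mul_nonneg (by positivity) (Finset.sum_nonneg fun i _ => ?_)
    have := hf.lipschitz_pos i
    have := stepBeta_nonneg hC hτ hτs ξ
    positivity
  -- A reference set and block: `N k` below counts the samplings for them, and by symmetry for every
  -- padded `J` and every block in it.
  obtain ⟨J₀, -, hJ₀⟩ := hP.exists_superset (J := ∅) (ξ := ξ) (by simp) (hP.xi_le 𝒥)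
  obtain ⟨i₀, hi₀⟩ : (P ⟨0, hC⟩ ∩ J₀).Nonempty := by
    rw [← Finset.card_pos, hJ₀]
    exact hξ
  replace hi₀ := (Finset.mem_inter.1 hi₀).2
  let N : ℕ → ℝ := fun k =>
    (((samplings P τ).filter fun Z => i₀ ∈ Z ∧ (J₀ ∩ Z).card = k).card : ℝ)
  let φ : (BlockSpace d → ℝ) → ℕ → Fin n → ℝ := fun g k i =>
    g (x + PiLp.single 2 i ((k : ℝ) • t i)) - g x
  have hJle : ∀ J ∈ 𝒥, ∑ Z ∈ samplings P τ,
      (fJ J (x + ∑ i ∈ Z, PiLp.single 2 i (t i)) - fJ J x) ≤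
      ∑ i, ∑ k ∈ Finset.range (n + 1), N k * ((k : ℝ)⁻¹ * φ (fJ J) k i) := by
    intro J hJ
    obtain ⟨J', hJJ', hJ'⟩ := hP.exists_superset (J := J) (card_inter_le_xi hJ) (hP.xi_le 𝒥)
    calc _ ≤ ∑ Z ∈ samplings P τ, ∑ i ∈ J' ∩ Z, ((J' ∩ Z).card : ℝ)⁻¹ *
          φ (fJ J) (J' ∩ Z).card i := Finset.sum_le_sum fun Z _ =>
            convex_joint_step_le (hf.convex J hJ) hJJ' (hf.depends J hJ) x t Z
      _ = ∑ i ∈ J', ∑ k ∈ Finset.range (n + 1), N k * ((k : ℝ)⁻¹ * φ (fJ J) k i) := by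
        rw [sum_sum_inter (samplings P τ) J' fun k i => (k : ℝ)⁻¹ * φ (fJ J) k i]
        refine Finset.sum_congr rfl fun i hi => Finset.sum_congr rfl fun k _ => ?_
        rw [hP.card_filter_mem_card_inter_eq hJ' hJ₀ hi hi₀]
      _ = _ := by
        refine Finset.sum_subset (Finset.subset_univ _) fun i _ hi => ?_
        refine Finset.sum_eq_zero fun k _ => ?_
        have : φ (fJ J) k i = 0 := by
          refine sub_eq_zero.2 (hf.depends J hJ _ _ fun j hj => ?_)
          have : j ≠ i := fun h => hi (hJJ' (h ▸ hj))
          simp [this]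
        rw [this, mul_zero, mul_zero]
  -- As the coefficients are independent of `J`, the single block increments of the `f_J` add up to
  -- those of `f`.
  have hsum : ∑ Z ∈ samplings P τ, (f (x + ∑ i ∈ Z, PiLp.single 2 i (t i)) - f x) ≤
      ∑ i, ∑ k ∈ Finset.range (n + 1), N k * ((k : ℝ)⁻¹ * φ f k i) := by
    have h1 := Finset.sum_le_sum hJle
    have h2 : ∀ k i, φ f k i = ∑ J ∈ 𝒥, φ (fJ J) k i := fun k i => by
      simp only [φ, hf.sum_eq, Finset.sum_sub_distrib]
    simp only [h2, Finset.mul_sum]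
    rw [Finset.sum_comm] at h1
    simp only [hf.sum_eq, ← Finset.sum_sub_distrib]
    refine h1.trans (le_of_eq ?_)
    rw [Finset.sum_comm]
    exact Finset.sum_congr rfl fun i _ => Finset.sum_comm
  have hN0 : N 0 = 0 := by
    simp only [N, Nat.cast_eq_zero, Finset.card_eq_zero, Finset.filter_eq_empty_iff]
    rintro Z - ⟨h1, h2⟩
    exact Finset.notMem_empty i₀ (h2 ▸ Finset.mem_inter.2 ⟨hi₀, h1⟩)
  have hN1 : ∑ k ∈ Finset.range (n + 1), N k = τ / s * (samplings P τ).card := by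
    have := sum_filter_mem_eq_sum_card (samplings P τ) J₀ i₀ fun _ => 1
    rw [Finset.sum_const, nsmul_eq_mul, hP.cast_card_filter_mem hs] at this
    simpa using this.symm
  have hN2 : ∑ k ∈ Finset.range (n + 1), N k * k =
      τ / s * (samplings P τ).card * stepBeta C s τ ξ := by
    rw [← hP.sum_filter_mem_card_inter hs hτ hJ₀ hi₀]
    exact (sum_filter_mem_eq_sum_card (samplings P τ) J₀ i₀ fun k => (k : ℝ)).symm
  have hbound : ∀ i, ∑ k ∈ Finset.range (n + 1), N k * ((k : ℝ)⁻¹ * φ f k i) ≤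
      τ / s * (samplings P τ).card * (⟪blockGradient f i x, t i⟫_ℝ
        + stepBeta C s τ ξ * L i / 2 * blockNorm (B i) (t i) ^ 2) := by
    intro i
    -- The quadratic bound is applied to the step `k • t i` and divided by `k`: the linear term
    -- loses its `k`, the quadratic one keeps a single factor. The index `k = 0` drops out since `N
    -- 0 = 0`.
    calc _ ≤ ∑ k ∈ Finset.range (n + 1), (N k * ⟪blockGradient f i x, t i⟫_ℝ
            + N k * k * (L i / 2 * blockNorm (B i) (t i) ^ 2)) := by
          refine Finset.sum_le_sum fun k _ => ?_
          rcases Nat.eq_zero_or_pos k with rfl | hk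
          · simp [hN0]
          have hk' : (0 : ℝ) < k := by exact_mod_cast hk
          have h1 := hf.le_add_single hB x i ((k : ℝ) • t i)
          rw [real_inner_smul_right, blockNorm_smul, abs_of_pos hk'] at h1
          rw [mul_assoc, ← mul_add]
          refine mul_le_mul_of_nonneg_left ?_ (Nat.cast_nonneg _)
          rw [inv_mul_le_iff₀ hk']
          simp only [φ]
          linarith
      _ = _ := by
          rw [Finset.sum_add_distrib, ← Finset.sum_mul, ← Finset.sum_mul, hN1, hN2]
          ring
  have hfinal := hsum.trans (Finset.sum_le_sum fun i _ => hbound i)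
  rw [Finset.sum_sub_distrib, Finset.sum_const, nsmul_eq_mul, ← Finset.mul_sum] at hfinal
  rw [mul_add]
  linarith

end DBCD

end

/-! ### The proximal block update and the one-step inequalities -/

noncomputable section

namespace DBCD

section Prox

variable {E : Type*} [NormedAddCommGroup E] [NormedSpace ℝ E]

theorem ClosedConvex.convex_combination {g : E → EReal} (hg : ClosedConvex g) {s t : E}
    (hs : g s ≠ ⊤) (ht : g t ≠ ⊤) {a : ℝ} (ha0 : 0 ≤ a) (ha1 : a ≤ 1) :
    g ((1 - a) • s + a • t) ≤ (((1 - a) * (g s).toReal + a * (g t).toReal : ℝ) : EReal) := by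
  have h1 : (s, (g s).toReal) ∈ {p : E × ℝ | g p.1 ≤ (p.2 : EReal)} := EReal.le_coe_toReal hs
  have h2 : (t, (g t).toReal) ∈ {p : E × ℝ | g p.1 ≤ (p.2 : EReal)} := EReal.le_coe_toReal ht
  exact hg.convex_epigraph h1 h2 (sub_nonneg.2 ha1) ha0 (by ring)

theorem ClosedConvex.coe_toReal {g : E → EReal} (hg : ClosedConvex g) {t : E} (ht : g t ≠ ⊤) :
    ((g t).toReal : EReal) = g t :=
  EReal.coe_toReal ht (hg.ne_bot t)

end Prox

variable {n C s τ : ℕ} {P : Fin C → Finset (Fin n)} {d : Fin n → ℕ}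
  {B : ∀ i, Matrix (Fin (d i)) (Fin (d i)) ℝ} {𝒥 : Finset (Finset (Fin n))}
  {fJ : Finset (Fin n) → BlockSpace d → ℝ} {L : Fin n → ℝ} {f : BlockSpace d → ℝ}
  {Om : ∀ i, EuclideanSpace ℝ (Fin (d i)) → EReal} {β : ℝ} {w : Fin n → ℝ}
  {h : BlockSpace d → BlockSpace d}

/-- The real value of the block model, where `Ω_i` is finite. -/
def realBlockModel (B : ∀ i, Matrix (Fin (d i)) (Fin (d i)) ℝ)
    (f : BlockSpace d → ℝ) (Om : ∀ i, EuclideanSpace ℝ (Fin (d i)) → EReal)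
    (β : ℝ) (w : Fin n → ℝ) (x : BlockSpace d) (i : Fin n) (t : EuclideanSpace ℝ (Fin (d i))) : ℝ :=
  ⟪blockGradient f i x, t⟫_ℝ + β * w i / 2 * blockNorm (B i) t ^ 2 + (Om i (x i + t)).toReal

theorem blockModel_eq_coe {i : Fin n} (hOm : ClosedConvex (Om i)) {x : BlockSpace d}
    {t : EuclideanSpace ℝ (Fin (d i))} (ht : Om i (x i + t) ≠ ⊤) :
    blockModel B f Om β w x i t = (realBlockModel B f Om β w x i t : EReal) := by
  rw [blockModel, realBlockModel, EReal.coe_add (_ + _), hOm.coe_toReal ht]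

/-- A minimizer cannot have value `+∞` when some competitor `t` has a finite one. With `t = 0` this
keeps the iterates in the domain of `Ω`. -/
theorem IsBlockUpdate.ne_top (hh : IsBlockUpdate B f Om β w h) {i : Fin n}
    (hOm : ClosedConvex (Om i)) (x : BlockSpace d)
    {t : EuclideanSpace ℝ (Fin (d i))} (ht : Om i (x i + t) ≠ ⊤) :
    Om i (x i + h x i) ≠ ⊤ := by
  intro htop
  have h1 : blockModel B f Om β w x i (h x i) ≤ blockModel B f Om β w x i t :=
    hh x i (Set.mem_univ t)
  rw [blockModel_eq_coe hOm ht, blockModel, htop, EReal.coe_add_top, top_le_iff] at h1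
  exact EReal.coe_ne_top _ h1

/-- The minimizer of the block model is a strong minimizer. -/
theorem IsBlockUpdate.realBlockModel_add_le (hh : IsBlockUpdate B f Om β w h) {i : Fin n}
    (hB : (B i).PosDef) (hOm : ClosedConvex (Om i)) (x : BlockSpace d)
    {t : EuclideanSpace ℝ (Fin (d i))} (ht : Om i (x i + t) ≠ ⊤) :
    realBlockModel B f Om β w x i (h x i) + β * w i / 2 * blockNorm (B i) (t - h x i) ^ 2 ≤
      realBlockModel B f Om β w x i t := by
  have hh_top := hh.ne_top hOm x ht
  -- Comparing `u` with `(1 - a) u + a t` and dividing by `a` gives the claim up to a factor `1 -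
  -- a`, which disappears as `a → 0`.
  set u := h x i with hu
  have key : ∀ a : ℝ, 0 < a → a ≤ 1 → realBlockModel B f Om β w x i u
      + (1 - a) * (β * w i / 2 * blockNorm (B i) (t - u) ^ 2) ≤
        realBlockModel B f Om β w x i t := by
    intro a ha0 ha1
    have hpt : x i + ((1 - a) • u + a • t) = (1 - a) • (x i + u) + a • (x i + t) := by module
    have hconv := hOm.convex_combination hh_top ht ha0.le ha1
    rw [← hpt] at hconv
    have hne : Om i (x i + ((1 - a) • u + a • t)) ≠ ⊤ := fun h0 =>
      EReal.coe_ne_top _ (top_le_iff.1 (h0 ▸ hconv))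
    have h1 : blockModel B f Om β w x i u ≤
        blockModel B f Om β w x i ((1 - a) • u + a • t) := hh x i (Set.mem_univ _)
    rw [blockModel_eq_coe hOm hh_top, blockModel_eq_coe hOm hne, EReal.coe_le_coe_iff] at h1
    rw [← hOm.coe_toReal hne, EReal.coe_le_coe_iff] at hconv
    have h2 : realBlockModel B f Om β w x i ((1 - a) • u + a • t) ≤
        (1 - a) * realBlockModel B f Om β w x i u + a * realBlockModel B f Om β w x i t
          - a * (1 - a) * (β * w i / 2 * blockNorm (B i) (t - u) ^ 2) := by
      unfold realBlockModel
      rw [blockNorm_sq_convex_combination hB, inner_add_right, real_inner_smul_right,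
        real_inner_smul_right]
      linarith
    refine le_of_mul_le_mul_left ?_ ha0
    linarith
  have hlim : Filter.Tendsto (fun a : ℝ => realBlockModel B f Om β w x i u
      + (1 - a) * (β * w i / 2 * blockNorm (B i) (t - u) ^ 2)) (nhdsWithin 0 (Set.Ioi 0))
      (nhds (realBlockModel B f Om β w x i u
        + (1 - 0) * (β * w i / 2 * blockNorm (B i) (t - u) ^ 2))) :=
    (Continuous.tendsto (by fun_prop) 0).mono_left nhdsWithin_le_nhds
  rw [sub_zero, one_mul] at hlim
  refine le_of_tendsto hlim ?_
  filter_upwards [Ioc_mem_nhdsGT (zero_lt_one' ℝ)] with a ha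
  exact key a ha.1 ha.2

/-- The real value of the objective, where it is finite. -/
def realObjective (f : BlockSpace d → ℝ) (Om : ∀ i, EuclideanSpace ℝ (Fin (d i)) → EReal)
    (x : BlockSpace d) : ℝ :=
  f x + ∑ i, (Om i (x i)).toReal

theorem objective_eq_coe (hOm : ∀ i, ClosedConvex (Om i)) {x : BlockSpace d}
    (hx : ∀ i, Om i (x i) ≠ ⊤) : objective f Om x = (realObjective f Om x : EReal) := by
  rw [objective, realObjective, EReal.coe_add, separable]
  congr 1
  have : ∀ A : Finset (Fin n), ((∑ i ∈ A, (Om i (x i)).toReal : ℝ) : EReal) =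
      ∑ i ∈ A, Om i (x i) := by
    intro A
    induction A using Finset.induction_on with
    | empty => simp
    | insert i A hi ih =>
      rw [Finset.sum_insert hi, Finset.sum_insert hi, EReal.coe_add, ih,
        (hOm i).coe_toReal (hx i)]
  exact (this _).symm

theorem sum_ereal_ne_bot {ι : Type*} (A : Finset ι) (g : ι → EReal) (hg : ∀ i, g i ≠ ⊥) :
    ∑ i ∈ A, g i ≠ ⊥ := by
  classical
  induction A using Finset.induction_on with
  | empty => simp
  | insert i A hi ih =>
    rw [Finset.sum_insert hi, Ne, EReal.add_eq_bot_iff]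
    tauto

/-- Closed convex functions here avoid `-∞`, so an infinite summand cannot be cancelled by the
`EReal` convention `⊤ + ⊥ = ⊥`. -/
theorem objective_eq_top (hOm : ∀ i, ClosedConvex (Om i)) {x : BlockSpace d} {i : Fin n}
    (hx : Om i (x i) = ⊤) : objective f Om x = ⊤ := by
  rw [objective, separable, ← Finset.add_sum_erase _ _ (Finset.mem_univ i), hx,
    EReal.top_add_of_ne_bot (sum_ereal_ne_bot _ _ fun j => (hOm j).ne_bot _), EReal.coe_add_top]

theorem weightedNorm_sq (hw : ∀ i, 0 < w i) (x : BlockSpace d) :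
    weightedNorm B w x ^ 2 = ∑ i, w i * blockNorm (B i) (x i) ^ 2 :=
  Real.sq_sqrt (Finset.sum_nonneg fun i _ => mul_nonneg (hw i).le (sq_nonneg _))

/-- The step from `x` along the blocks in `Z`. -/
def blockStep (h : BlockSpace d → BlockSpace d) (x : BlockSpace d) (Z : Finset (Fin n)) :
    BlockSpace d :=
  x + ∑ i ∈ Z, PiLp.single 2 i (h x i)

theorem blockStep_apply (x : BlockSpace d) (Z : Finset (Fin n)) (i : Fin n) :
    blockStep h x Z i = if i ∈ Z then x i + h x i else x i := by
  rw [blockStep, PiLp.add_apply, sum_single_apply (fun i => h x i)]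
  split_ifs <;> simp

theorem IsBlockUpdate.blockStep_ne_top (hh : IsBlockUpdate B f Om β w h)
    (hOm : ∀ i, ClosedConvex (Om i)) {x : BlockSpace d} (hx : ∀ i, Om i (x i) ≠ ⊤)
    (Z : Finset (Fin n)) (i : Fin n) : Om i (blockStep h x Z i) ≠ ⊤ := by
  rw [blockStep_apply]
  split_ifs
  · exact hh.ne_top (hOm i) x (t := 0) (by simpa using hx i)
  · exact hx i

section OneStep

variable (hB : ∀ i, (B i).PosDef) (hf : SmoothPartiallySeparable B 𝒥 fJ L f)
  (hOm : ∀ i, ClosedConvex (Om i)) (hC : 0 < C) (hP : BalancedPartition P s)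
  (hτ : 1 ≤ τ) (hτs : τ ≤ s) (hβ : β = stepBeta C s τ (xi P 𝒥))
  (hh : IsBlockUpdate B f Om β L h)

include hB hf hC hP hτ hτs hβ in
-- The overapproximation bounds the smooth part; the separable part averages exactly, block by
-- block.
theorem sum_samplings_realObjective_le (x : BlockSpace d) :
    ∑ Z ∈ samplings P τ, realObjective f Om (blockStep h x Z) ≤
      (samplings P τ).card * ((1 - τ / s) * realObjective f Om x +
        τ / s * (f x + ∑ i, realBlockModel B f Om β L x i (h x i))) := by
  have h1 := hf.sum_samplings_le hB hC hP hτ hτs x (fun i => h x i)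
  have h2 : ∑ Z ∈ samplings P τ, ∑ i, (Om i (blockStep h x Z i)).toReal =
      (samplings P τ).card * ((1 - τ / s) * ∑ i, (Om i (x i)).toReal +
        τ / s * ∑ i, (Om i (x i + h x i)).toReal) := by
    rw [Finset.sum_comm]
    have : ∀ i, ∑ Z ∈ samplings P τ, (Om i (blockStep h x Z i)).toReal =
        (samplings P τ).card * ((1 - τ / s) * (Om i (x i)).toReal +
          τ / s * (Om i (x i + h x i)).toReal) := by
      intro i
      rw [← sum_samplings_ite hP (by omega) i]
      refine Finset.sum_congr rfl fun Z _ => ?_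
      rw [blockStep_apply]
      split_ifs <;> rfl
    simp only [this, ← Finset.mul_sum, Finset.sum_add_distrib]
  simp only [realObjective, Finset.sum_add_distrib, h2, realBlockModel]
  rw [← hβ] at h1
  unfold blockStep
  simp only [Finset.sum_add_distrib] at h1
  linarith

include hB hf hOm hh in
-- Each block subproblem is compared with the zero step.
theorem model_le_realObjective (hβ0 : 0 ≤ β) {x : BlockSpace d} (hx : ∀ i, Om i (x i) ≠ ⊤) :
    f x + ∑ i, realBlockModel B f Om β L x i (h x i) ≤ realObjective f Om x := by
  refine add_le_add_right (Finset.sum_le_sum fun i _ => ?_) (f x)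
  have h1 := hh.realBlockModel_add_le (hB i) (hOm i) x (t := 0) (by simpa using hx i)
  have h2 : 0 ≤ β * L i / 2 * blockNorm (B i) (0 - h x i) ^ 2 := by
    have := hf.lipschitz_pos i
    positivity
  have h3 : realBlockModel B f Om β L x i 0 = (Om i (x i)).toReal := by
    simp [realBlockModel, blockNorm]
  linarith

include hB hf hOm hh in
-- The three-point inequality: strong minimality against `t = y i - x i` in each block, then the
-- tangent inequality replaces the linearization of `f` by `f y`.
theorem model_add_le (x : BlockSpace d) {y : BlockSpace d} (hy : ∀ i, Om i (y i) ≠ ⊤) :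
    f x + ∑ i, realBlockModel B f Om β L x i (h x i)
        + β / 2 * ∑ i, L i * blockNorm (B i) (x i + h x i - y i) ^ 2 ≤
      realObjective f Om y + β / 2 * ∑ i, L i * blockNorm (B i) (x i - y i) ^ 2 := by
  have hneg : ∀ (i : Fin n) (t : EuclideanSpace ℝ (Fin (d i))),
      blockNorm (B i) (-t) = blockNorm (B i) t := by
    intro i t
    simpa using blockNorm_smul (B := B i) (-1) t
  have h1 : ∀ i, realBlockModel B f Om β L x i (h x i)
      + β / 2 * (L i * blockNorm (B i) (x i + h x i - y i) ^ 2) ≤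
      ⟪blockGradient f i x, (y - x) i⟫_ℝ + (Om i (y i)).toReal
        + β / 2 * (L i * blockNorm (B i) (x i - y i) ^ 2) := by
    intro i
    have := hh.realBlockModel_add_le (hB i) (hOm i) x (t := y i - x i)
      (by simpa using hy i)
    rw [← hneg i (x i + h x i - y i), ← hneg i (x i - y i), neg_sub, neg_sub, ← sub_sub]
    rw [realBlockModel.eq_def B f Om β L x i (y i - x i), add_sub_cancel] at this
    rw [PiLp.sub_apply]
    linarith
  have h2 := Finset.sum_le_sum fun i (_ : i ∈ Finset.univ) => h1 i
  have h3 := add_inner_gradient_le hf.convexOn hf.differentiable x y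
  rw [PiLp.inner_apply] at h3
  simp only [Finset.sum_add_distrib, ← Finset.mul_sum] at h2
  simp only [realObjective]
  simp only [blockGradient] at h2
  linarith

include hB hf hOm hC hP hτ hτs hβ hh in
/-- The objective does not increase in expectation. -/
theorem sum_samplings_realObjective_le_self {x : BlockSpace d} (hx : ∀ i, Om i (x i) ≠ ⊤) :
    ∑ Z ∈ samplings P τ, realObjective f Om (blockStep h x Z) ≤
      (samplings P τ).card * realObjective f Om x := by
  have hs : (0 : ℝ) < s := by exact_mod_cast (by omega : 0 < s)
  refine (sum_samplings_realObjective_le hB hf hC hP hτ hτs hβ x).trans ?_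
  refine mul_le_mul_of_nonneg_left ?_ (Nat.cast_nonneg _)
  have h1 := model_le_realObjective hB hf hOm hh (hβ ▸ stepBeta_nonneg hC hτ hτs _) hx
  have h2 := mul_le_mul_of_nonneg_left h1 (by positivity : (0 : ℝ) ≤ τ / s)
  linarith

include hB hf hOm hC hP hτ hτs hβ hh in
/-- The expected decrease of the potential `(β / 2) ‖x - y‖_w^2 + F(x) - F(y)`. -/
theorem sum_samplings_potential_le (x : BlockSpace d)
    {y : BlockSpace d} (hy : ∀ i, Om i (y i) ≠ ⊤) :
    ∑ Z ∈ samplings P τ, (β / 2 * weightedNorm B L (blockStep h x Z - y) ^ 2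
        + (realObjective f Om (blockStep h x Z) - realObjective f Om y)) ≤
      (samplings P τ).card * (β / 2 * weightedNorm B L (x - y) ^ 2
        + (1 - τ / s) * (realObjective f Om x - realObjective f Om y)) := by
  have hs : (0 : ℝ) < s := by exact_mod_cast (by omega : 0 < s)
  have h1 : ∑ Z ∈ samplings P τ, weightedNorm B L (blockStep h x Z - y) ^ 2 =
      (samplings P τ).card * ((1 - τ / s) * ∑ i, L i * blockNorm (B i) (x i - y i) ^ 2 +
        τ / s * ∑ i, L i * blockNorm (B i) (x i + h x i - y i) ^ 2) := by
    simp only [weightedNorm_sq hf.lipschitz_pos]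
    rw [Finset.sum_comm]
    have : ∀ i, ∑ Z ∈ samplings P τ, L i * blockNorm (B i) ((blockStep h x Z - y) i) ^ 2 =
        (samplings P τ).card * ((1 - τ / s) * (L i * blockNorm (B i) (x i - y i) ^ 2) +
          τ / s * (L i * blockNorm (B i) (x i + h x i - y i) ^ 2)) := by
      intro i
      rw [← sum_samplings_ite hP (by omega) i]
      refine Finset.sum_congr rfl fun Z _ => ?_
      rw [PiLp.sub_apply, blockStep_apply]
      split_ifs <;> rfl
    simp only [this, ← Finset.mul_sum, Finset.sum_add_distrib]
  have h2 := sum_samplings_realObjective_le (Om := Om) (h := h) hB hf hC hP hτ hτs hβ x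
  -- Scaled by `τ / s`, the distance of the full step to `y` on the left of `model_add_le` cancels
  -- the same term in the averaged norm `h1`.
  have h3 := mul_le_mul_of_nonneg_left (model_add_le hB hf hOm hh x hy)
    (by positivity : (0 : ℝ) ≤ (samplings P τ).card * (τ / s))
  rw [Finset.sum_add_distrib, Finset.sum_sub_distrib, ← Finset.mul_sum, h1, Finset.sum_const,
    nsmul_eq_mul, weightedNorm_sq hf.lipschitz_pos]
  simp only [PiLp.sub_apply]
  linarith

end OneStep

end DBCD

end

/-! ### From random draws to averages over samplings -/

noncomputable section

namespace DBCD

open MeasureTheory ProbabilityTheory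

variable {n C s τ : ℕ} {P : Fin C → Finset (Fin n)} {d : Fin n → ℕ}
  {S : Type*} [MeasurableSpace S] {μ : Measure S} {Z : ℕ → Fin C → S → Finset (Fin n)}

theorem lintegral_uniformOn {α : Type*} [MeasurableSpace α] [MeasurableSingletonClass α]
    (A : Finset α) (G : α → ℝ≥0∞) :
    ∫⁻ a, G a ∂uniformOn (A : Set α) = (A.card : ℝ≥0∞)⁻¹ * ∑ a ∈ A, G a := by
  rw [uniformOn, ProbabilityTheory.cond, lintegral_smul_measure, lintegral_finset,
    Measure.count_apply_finset, smul_eq_mul]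
  simp

/-- The joint law of the draws of one iteration. -/
theorem DistributedSamplings.map_eq [IsProbabilityMeasure μ]
    (hZ : DistributedSamplings μ P τ Z) (k : ℕ) :
    μ.map (fun ω c => Z k c ω) = uniformOn
      (Fintype.piFinset (fun c => Finset.powersetCard τ (P c)) : Set (Fin C → Finset (Fin n))) := by
  have hind : iIndepFun (fun c => Z k c) μ :=
    hZ.indep.precomp (g := fun c : Fin C => (k, c)) fun a b h => (Prod.ext_iff.1 h).2
  rw [(iIndepFun_iff_map_fun_eq_pi_map fun c => (hZ.measurable k c).aemeasurable).1 hind,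
    Fintype.coe_piFinset, uniformOn_pi]
  simp only [hZ.law]

/-- A function of the draws of the iterations before `k` is independent of the draws of
iteration `k`. -/
theorem DistributedSamplings.lintegral_past_now [IsProbabilityMeasure μ]
    (hZ : DistributedSamplings μ P τ Z) (hP : BalancedPartition P s) (k : ℕ) {α : Type*}
    (X : S → α) (hX : ∀ ω ω', (∀ j < k, ∀ c, Z j c ω = Z j c ω') → X ω = X ω')
    (G : α → Finset (Fin n) → ℝ≥0∞) :
    ∫⁻ ω, G (X ω) (sampledBlocks Z k ω) ∂μ =
      ∫⁻ ω, ((samplings P τ).card : ℝ≥0∞)⁻¹ * ∑ A ∈ samplings P τ, G (X ω) A ∂μ := by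
  let T : Finset (ℕ × Fin C) := Finset.range k ×ˢ Finset.univ
  let past : S → (T → Finset (Fin n)) := fun ω q => Z q.1.1 q.1.2 ω
  let now : S → (Fin C → Finset (Fin n)) := fun ω c => Z k c ω
  have hpast : Measurable past := measurable_pi_lambda _ fun q => hZ.measurable _ _
  have hnow : Measurable now := measurable_pi_lambda _ fun c => hZ.measurable _ _
  have hind : IndepFun past now μ := by
    have h1 := hZ.indep.indepFun_finset T ({k} ×ˢ Finset.univ) (by
      rw [Finset.disjoint_left]
      rintro ⟨j, c⟩ h1 h2
      simp only [T, Finset.mem_product, Finset.mem_range, Finset.mem_singleton] at h1 h2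
      omega) fun q => hZ.measurable _ _
    exact h1.comp (φ := id) (ψ := fun z c => z ⟨(k, c), by simp⟩) measurable_id
      (measurable_pi_lambda _ fun c => measurable_pi_apply _)
  obtain ⟨ω₀⟩ : Nonempty S := nonempty_of_isProbabilityMeasure μ
  -- `X` factors through the past draws, a finite discrete space. Hence `Φ` may be arbitrary and `α`
  -- needs no measurable structure.
  obtain ⟨Φ, hΦ⟩ : ∃ Φ : (T → Finset (Fin n)) → α, ∀ ω, X ω = Φ (past ω) := by
    refine ⟨Function.extend past X fun _ => X ω₀, fun ω => ?_⟩
    refine (Function.FactorsThrough.extend_apply ?_ _ ω).symm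
    intro ω ω' h
    refine hX ω ω' fun j hj c => ?_
    exact congrFun h ⟨(j, c), by simp [T, hj]⟩
  have hmap := (indepFun_iff_map_prod_eq_prod_map_map hpast.aemeasurable hnow.aemeasurable).1 hind
  have hnowlaw : μ.map now = _ := hZ.map_eq k
  have hprob : IsProbabilityMeasure (μ.map now) :=
    Measure.isProbabilityMeasure_map hnow.aemeasurable
  have hcard : (Fintype.piFinset (fun c => Finset.powersetCard τ (P c))).card =
      (samplings P τ).card := by
    rw [Finset.card_eq_sum_ones, Finset.card_eq_sum_ones]
    exact hP.sum_piFinset fun _ => 1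
  calc ∫⁻ ω, G (X ω) (sampledBlocks Z k ω) ∂μ
      = ∫⁻ ω, (fun q : (T → Finset (Fin n)) × (Fin C → Finset (Fin n)) =>
          G (Φ q.1) (Finset.univ.biUnion q.2)) (past ω, now ω) ∂μ := by
        simp only [hΦ]
        rfl
    _ = ∫⁻ p, ∫⁻ z, G (Φ p) (Finset.univ.biUnion z) ∂(μ.map now) ∂(μ.map past) := by
        rw [← lintegral_map (f := fun q : (T → Finset (Fin n)) × (Fin C → Finset (Fin n)) =>
          G (Φ q.1) (Finset.univ.biUnion q.2)) (measurable_of_countable _) (hpast.prodMk hnow),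
          hmap, lintegral_prod _ (measurable_of_countable _).aemeasurable]
    _ = ∫⁻ p, ((samplings P τ).card : ℝ≥0∞)⁻¹ * ∑ A ∈ samplings P τ, G (Φ p) A
          ∂(μ.map past) := by
        simp only [hnowlaw, lintegral_uniformOn, hcard, hP.sum_piFinset]
    _ = _ := by
        rw [lintegral_map (measurable_of_countable _) hpast]
        simp only [hΦ]

theorem iterate_eq_of_past {S : Type*} {Z : ℕ → Fin C → S → Finset (Fin n)} {h : BlockSpace d → BlockSpace d}
    {x₀ : BlockSpace d} {ω ω' : S}
    (k : ℕ) (hω : ∀ j < k, ∀ c, Z j c ω = Z j c ω') :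
    iterate h Z x₀ k ω = iterate h Z x₀ k ω' := by
  induction k with
  | zero => rfl
  | succ k ih =>
    have h1 := ih fun j hj => hω j (by omega)
    have h2 : sampledBlocks Z k ω = sampledBlocks Z k ω' := by
      simp only [sampledBlocks, hω k (by omega)]
    simp only [iterate, h1, h2]

/-- The conditional expectation of a function of the next iterate, given the present one. -/
theorem DistributedSamplings.lintegral_iterate_succ [IsProbabilityMeasure μ]
    (hZ : DistributedSamplings μ P τ Z) (hP : BalancedPartition P s)
    (h : BlockSpace d → BlockSpace d) (x₀ : BlockSpace d) (k : ℕ) (G : BlockSpace d → ℝ≥0∞) :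
    ∫⁻ ω, G (iterate h Z x₀ (k + 1) ω) ∂μ =
      ∫⁻ ω, ((samplings P τ).card : ℝ≥0∞)⁻¹ *
        ∑ A ∈ samplings P τ, G (blockStep h (iterate h Z x₀ k ω) A) ∂μ :=
  hZ.lintegral_past_now hP k (iterate h Z x₀ k) (fun _ _ hω => iterate_eq_of_past k hω)
    fun x A => G (blockStep h x A)

/-- Neither `h` nor `G` need be measurable: the iterate is a function of finitely many draws with
values in a finite set. -/
theorem measurable_comp_iterate (hZ : DistributedSamplings μ P τ Z)
    (h : BlockSpace d → BlockSpace d) (x₀ : BlockSpace d) (k : ℕ) (G : BlockSpace d → ℝ≥0∞) :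
    Measurable fun ω => G (iterate h Z x₀ k ω) := by
  let past : S → (Fin k × Fin C → Finset (Fin n)) := fun ω q => Z q.1 q.2 ω
  have hpast : Measurable past := measurable_pi_lambda _ fun q => hZ.measurable _ _
  have hfac : (iterate h Z x₀ k).FactorsThrough past := fun ω ω' hω =>
    iterate_eq_of_past k fun j hj c => congrFun hω (⟨j, hj⟩, c)
  have : (fun ω => G (iterate h Z x₀ k ω)) =
      (fun p => G (Function.extend past (iterate h Z x₀ k) (fun _ => x₀) p)) ∘ past := by
    funext ω
    rw [Function.comp_apply, hfac.extend_apply]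
  rw [this]
  exact (measurable_of_countable _).comp hpast

theorem average_ofReal_le {ι : Type*} {A : Finset ι} {v : ι → ℝ} {r : ℝ}
    (hv : ∀ i ∈ A, 0 ≤ v i) (h : ∑ i ∈ A, v i ≤ A.card * r) :
    (A.card : ℝ≥0∞)⁻¹ * ∑ i ∈ A, ENNReal.ofReal (v i) ≤ ENNReal.ofReal r := by
  rw [← ENNReal.ofReal_sum_of_nonneg hv, mul_comm, ← div_eq_mul_inv]
  refine ENNReal.div_le_of_le_mul' ?_
  rw [← ENNReal.ofReal_natCast, ← ENNReal.ofReal_mul (Nat.cast_nonneg _)]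
  exact ENNReal.ofReal_le_ofReal h

section Gap

variable {f : BlockSpace d → ℝ} {Om : ∀ i, EuclideanSpace ℝ (Fin (d i)) → EReal}
  {xstar : BlockSpace d}

theorem optimalValue_eq (hxstar : IsMinOn (objective f Om) Set.univ xstar) :
    optimalValue f Om = objective f Om xstar :=
  le_antisymm (iInf_le _ _) (le_iInf fun x => hxstar (Set.mem_univ x))

theorem ne_top_of_objective_ne_top (hOm : ∀ i, ClosedConvex (Om i)) {x : BlockSpace d}
    (hx : objective f Om x ≠ ⊤) (i : Fin n) : Om i (x i) ≠ ⊤ :=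
  fun h => hx (objective_eq_top hOm h)

theorem realObjective_le (hOm : ∀ i, ClosedConvex (Om i))
    (hxstar : IsMinOn (objective f Om) Set.univ xstar) (hfin : objective f Om xstar ≠ ⊤)
    {x : BlockSpace d} (hx : ∀ i, Om i (x i) ≠ ⊤) :
    realObjective f Om xstar ≤ realObjective f Om x := by
  have : objective f Om xstar ≤ objective f Om x := hxstar (Set.mem_univ x)
  rwa [objective_eq_coe hOm hx, objective_eq_coe hOm (ne_top_of_objective_ne_top hOm hfin),
    EReal.coe_le_coe_iff] at this

theorem gap_eq_ofReal (hOm : ∀ i, ClosedConvex (Om i))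
    (hxstar : IsMinOn (objective f Om) Set.univ xstar) (hfin : objective f Om xstar ≠ ⊤)
    {x : BlockSpace d} (hx : ∀ i, Om i (x i) ≠ ⊤) :
    gap f Om x = ENNReal.ofReal (realObjective f Om x - realObjective f Om xstar) := by
  rw [gap, optimalValue_eq hxstar, objective_eq_coe hOm hx,
    objective_eq_coe hOm (ne_top_of_objective_ne_top hOm hfin), ← EReal.coe_sub,
    EReal.toENNReal_of_ne_top (EReal.coe_ne_top _), EReal.toReal_coe]

theorem gap_eq_top (hOm : ∀ i, ClosedConvex (Om i))
    (hxstar : IsMinOn (objective f Om) Set.univ xstar) (hfin : objective f Om xstar ≠ ⊤)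
    {x : BlockSpace d} {i : Fin n} (hx : Om i (x i) = ⊤) : gap f Om x = ⊤ := by
  rw [gap, optimalValue_eq hxstar, objective_eq_top hOm hx,
    objective_eq_coe hOm (ne_top_of_objective_ne_top hOm hfin), EReal.top_sub_coe,
    EReal.toENNReal_top]

end Gap

theorem BalancedPartition.card_eq_mul (hP : BalancedPartition P s) : n = C * s := by
  have h1 : (Finset.univ : Finset (Fin n)) = Finset.univ.biUnion P := by
    ext a
    simpa using hP.cover a
  have h3 := congrArg Finset.card h1
  rw [Finset.card_biUnion fun c _ c' _ hne => hP.disjoint c c' hne,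
    Finset.sum_congr rfl fun c _ => hP.card_eq c] at h3
  simpa using h3

end DBCD

end

/-! ### Telescoping and the rate -/

noncomputable section

namespace DBCD

open MeasureTheory

section Convergence

variable {n C s τ : ℕ} {P : Fin C → Finset (Fin n)} {d : Fin n → ℕ}
  {B : ∀ i, Matrix (Fin (d i)) (Fin (d i)) ℝ} {𝒥 : Finset (Finset (Fin n))}
  {fJ : Finset (Fin n) → BlockSpace d → ℝ} {L : Fin n → ℝ} {f : BlockSpace d → ℝ}
  {Om : ∀ i, EuclideanSpace ℝ (Fin (d i)) → EReal} {β : ℝ}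
  {h : BlockSpace d → BlockSpace d} {xstar : BlockSpace d}
  {S : Type*} [MeasurableSpace S] {μ : Measure S} {Z : ℕ → Fin C → S → Finset (Fin n)}

theorem initialError_eq_ofReal (hβ0 : 0 ≤ β) (hOm : ∀ i, ClosedConvex (Om i))
    (hxstar : IsMinOn (objective f Om) Set.univ xstar) (hfin : objective f Om xstar ≠ ⊤)
    {x : BlockSpace d} (hx : ∀ i, Om i (x i) ≠ ⊤) :
    initialError B f Om β L x xstar = ENNReal.ofReal (β / 2 * weightedNorm B L (x - xstar) ^ 2
      + (realObjective f Om x - realObjective f Om xstar)) := by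
  rw [initialError, gap_eq_ofReal hOm hxstar hfin hx, ENNReal.ofReal_add (by positivity)]
  exact sub_nonneg.2 (realObjective_le hOm hxstar hfin hx)

theorem iterate_ne_top {S : Type*} {Z : ℕ → Fin C → S → Finset (Fin n)}
    (hOm : ∀ i, ClosedConvex (Om i))
    (hh : IsBlockUpdate B f Om β L h) {x₀ : BlockSpace d} (hx₀ : ∀ i, Om i (x₀ i) ≠ ⊤) (k : ℕ) (ω : S) :
    ∀ i, Om i (iterate h Z x₀ k ω i) ≠ ⊤ := by
  induction k with
  | zero => exact hx₀
  | succ k ih => exact hh.blockStep_ne_top hOm ih _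

variable (hB : ∀ i, (B i).PosDef) (hf : SmoothPartiallySeparable B 𝒥 fJ L f)
  (hOm : ∀ i, ClosedConvex (Om i)) (hC : 0 < C) (hP : BalancedPartition P s)
  (hτ : 1 ≤ τ) (hτs : τ ≤ s) (hβ : β = stepBeta C s τ (xi P 𝒥))
  (hh : IsBlockUpdate B f Om β L h)
  (hxstar : IsMinOn (objective f Om) Set.univ xstar) (hfin : objective f Om xstar ≠ ⊤)

include hB hf hOm hC hP hτ hτs hβ hh hxstar hfin

theorem average_gap_le {x : BlockSpace d} (hx : ∀ i, Om i (x i) ≠ ⊤) :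
    ((samplings P τ).card : ℝ≥0∞)⁻¹ * ∑ A ∈ samplings P τ, gap f Om (blockStep h x A) ≤
      gap f Om x := by
  have hstep := fun A => hh.blockStep_ne_top hOm hx A
  rw [gap_eq_ofReal hOm hxstar hfin hx,
    Finset.sum_congr rfl fun A _ => gap_eq_ofReal hOm hxstar hfin (hstep A)]
  refine average_ofReal_le
    (fun A _ => sub_nonneg.2 (realObjective_le hOm hxstar hfin (hstep A))) ?_
  have := sum_samplings_realObjective_le_self hB hf hOm hC hP hτ hτs hβ hh hx
  rw [Finset.sum_sub_distrib, Finset.sum_const, nsmul_eq_mul]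
  linarith

/-- The mean decrease of the potential with `y = x^*`. The subtracted `τ / s` times the gap is moved
to the left, so that no subtraction occurs in `ℝ≥0∞`. -/
theorem average_initialError_add_le {x : BlockSpace d} (hx : ∀ i, Om i (x i) ≠ ⊤) :
    ((samplings P τ).card : ℝ≥0∞)⁻¹ *
        ∑ A ∈ samplings P τ, initialError B f Om β L (blockStep h x A) xstar
      + ENNReal.ofReal (τ / s) * gap f Om x ≤ initialError B f Om β L x xstar := by
  have hβ0 : 0 ≤ β := hβ ▸ stepBeta_nonneg hC hτ hτs _
  have hs : (0 : ℝ) < s := by exact_mod_cast (by omega : 0 < s)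
  have hα : (τ : ℝ) / s ≤ 1 := by
    rw [div_le_one hs]
    exact_mod_cast hτs
  have hstep := fun A => hh.blockStep_ne_top hOm hx A
  have hgap := sub_nonneg.2 (realObjective_le hOm hxstar hfin hx)
  have h1 := average_ofReal_le
    (v := fun A => β / 2 * weightedNorm B L (blockStep h x A - xstar) ^ 2
      + (realObjective f Om (blockStep h x A) - realObjective f Om xstar))
    (fun A _ => add_nonneg (by positivity)
      (sub_nonneg.2 (realObjective_le hOm hxstar hfin (hstep A))))
    (sum_samplings_potential_le hB hf hOm hC hP hτ hτs hβ hh x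
      (ne_top_of_objective_ne_top hOm hfin))
  rw [Finset.sum_congr rfl fun A _ => initialError_eq_ofReal hβ0 hOm hxstar hfin (hstep A),
    initialError_eq_ofReal hβ0 hOm hxstar hfin hx, gap_eq_ofReal hOm hxstar hfin hx,
    ← ENNReal.ofReal_mul (by positivity)]
  refine (add_le_add_left h1 _).trans ?_
  rw [← ENNReal.ofReal_add _ (mul_nonneg (by positivity) hgap)]
  · refine ENNReal.ofReal_le_ofReal (le_of_eq ?_)
    ring
  · exact add_nonneg (by positivity) (mul_nonneg (sub_nonneg.2 hα) hgap)

variable [IsProbabilityMeasure μ] (hZ : DistributedSamplings μ P τ Z)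

include hZ

theorem lintegral_gap_succ_le {x₀ : BlockSpace d} (hx₀ : ∀ i, Om i (x₀ i) ≠ ⊤) (k : ℕ) :
    ∫⁻ ω, gap f Om (iterate h Z x₀ (k + 1) ω) ∂μ ≤ ∫⁻ ω, gap f Om (iterate h Z x₀ k ω) ∂μ := by
  rw [hZ.lintegral_iterate_succ hP]
  exact lintegral_mono fun ω => average_gap_le hB hf hOm hC hP hτ hτs hβ hh hxstar hfin
    (iterate_ne_top hOm hh hx₀ k ω)

theorem lintegral_initialError_add_le {x₀ : BlockSpace d} (hx₀ : ∀ i, Om i (x₀ i) ≠ ⊤) (k : ℕ) :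
    ∫⁻ ω, initialError B f Om β L (iterate h Z x₀ (k + 1) ω) xstar ∂μ
        + ENNReal.ofReal (τ / s) * ∫⁻ ω, gap f Om (iterate h Z x₀ k ω) ∂μ ≤
      ∫⁻ ω, initialError B f Om β L (iterate h Z x₀ k ω) xstar ∂μ := by
  rw [hZ.lintegral_iterate_succ hP h x₀ k fun x => initialError B f Om β L x xstar,
    ← lintegral_const_mul _ (measurable_comp_iterate hZ h x₀ k (gap f Om)),
    ← lintegral_add_right _ ((measurable_comp_iterate hZ h x₀ k (gap f Om)).const_mul _)]
  exact lintegral_mono fun ω => average_initialError_add_le hB hf hOm hC hP hτ hτs hβ hh hxstar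
    hfin (iterate_ne_top hOm hh hx₀ k ω)

/-- The decreases contain the gaps at all earlier iterates; monotonicity of the mean gap lets the
latest gap stand in for each of them. -/
theorem lintegral_initialError_add_mul_le {x₀ : BlockSpace d} (hx₀ : ∀ i, Om i (x₀ i) ≠ ⊤)
    (k : ℕ) :
    ∫⁻ ω, initialError B f Om β L (iterate h Z x₀ k ω) xstar ∂μ
        + k * ENNReal.ofReal (τ / s) * ∫⁻ ω, gap f Om (iterate h Z x₀ k ω) ∂μ ≤
      initialError B f Om β L x₀ xstar := by
  induction k with
  | zero => simp [iterate]
  | succ k ih =>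
    have h1 := lintegral_initialError_add_le hB hf hOm hC hP hτ hτs hβ hh hxstar hfin hZ hx₀ k
    have h2 := lintegral_gap_succ_le hB hf hOm hC hP hτ hτs hβ hh hxstar hfin hZ hx₀ k
    calc _ ≤ ∫⁻ ω, initialError B f Om β L (iterate h Z x₀ (k + 1) ω) xstar ∂μ
          + ((k + 1 : ℕ) : ℝ≥0∞) * ENNReal.ofReal (τ / s)
            * ∫⁻ ω, gap f Om (iterate h Z x₀ k ω) ∂μ := by gcongr
      _ = (∫⁻ ω, initialError B f Om β L (iterate h Z x₀ (k + 1) ω) xstar ∂μ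
          + ENNReal.ofReal (τ / s) * ∫⁻ ω, gap f Om (iterate h Z x₀ k ω) ∂μ)
          + k * ENNReal.ofReal (τ / s) * ∫⁻ ω, gap f Om (iterate h Z x₀ k ω) ∂μ := by
        push_cast
        ring
      _ ≤ _ := (add_le_add_left h1 _).trans ih

/-- The sublinear rate of convergence. -/
theorem lintegral_gap_le (x₀ : BlockSpace d) (k : ℕ) :
    ∫⁻ ω, gap f Om (iterate h Z x₀ k ω) ∂μ ≤
      ENNReal.ofReal ((n : ℝ) / ((n : ℝ) + (C : ℝ) * (τ : ℝ) * (k : ℝ)))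
        * initialError B f Om β L x₀ xstar := by
  have hs : (0 : ℝ) < s := by exact_mod_cast (by omega : 0 < s)
  have hC' : (0 : ℝ) < C := by exact_mod_cast hC
  have hn : (n : ℝ) = C * s := by exact_mod_cast hP.card_eq_mul
  have hpos : (0 : ℝ) < 1 + (k : ℝ) * ((τ : ℝ) / s) := by positivity
  have hrate : (n : ℝ) / ((n : ℝ) + (C : ℝ) * (τ : ℝ) * (k : ℝ)) = (1 + (k : ℝ) * ((τ : ℝ) / s))⁻¹ := by
    rw [hn]
    field_simp
  rw [hrate]
  -- If `F(x₀) = +∞`, the right side is `∞` because the rate is positive. Otherwise all iterates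
  -- stay in the domain of `Ω`.
  by_cases hx₀ : ∀ i, Om i (x₀ i) ≠ ⊤
  · rw [ENNReal.ofReal_inv_of_pos hpos, mul_comm, ← div_eq_mul_inv,
      ENNReal.le_div_iff_mul_le (by simp [hpos]) (by simp), mul_comm,
      ENNReal.ofReal_add zero_le_one (by positivity), ENNReal.ofReal_mul (Nat.cast_nonneg _),
      ENNReal.ofReal_natCast, ENNReal.ofReal_one, add_mul, one_mul]
    refine le_trans ?_
      (lintegral_initialError_add_mul_le hB hf hOm hC hP hτ hτs hβ hh hxstar hfin hZ hx₀ k)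
    -- The squared distance in the potential is dropped, leaving one more copy of the gap: the `1`
    -- in `1 + k τ / s`.
    gcongr
    exact le_add_self
  · push Not at hx₀
    obtain ⟨i, hi⟩ := hx₀
    rw [initialError, gap_eq_top hOm hxstar hfin hi, add_top, ENNReal.mul_top]
    · exact le_top
    · simpa using hpos

end Convergence

end DBCD

end

theorem theorem2 {n C s τ : ℕ} (d : Fin n → ℕ)
    (B : ∀ i, Matrix (Fin (d i)) (Fin (d i)) ℝ) (hB : ∀ i, (B i).PosDef)
    (f : DBCD.BlockSpace d → ℝ) (𝒥 : Finset (Finset (Fin n)))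
    (fJ : Finset (Fin n) → DBCD.BlockSpace d → ℝ) (L : Fin n → ℝ)
    (hf : DBCD.SmoothPartiallySeparable B 𝒥 fJ L f)
    (Om : ∀ i, EuclideanSpace ℝ (Fin (d i)) → EReal) (hOm : ∀ i, DBCD.ClosedConvex (Om i))
    (hC : 0 < C) (P : Fin C → Finset (Fin n)) (hP : DBCD.BalancedPartition P s)
    (hτ : 1 ≤ τ) (hτs : τ ≤ s)
    {S : Type*} [MeasurableSpace S] (μ : MeasureTheory.Measure S)
    [MeasureTheory.IsProbabilityMeasure μ]
    (Z : ℕ → Fin C → S → Finset (Fin n)) (hZ : DBCD.DistributedSamplings μ P τ Z)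
    (β : ℝ) (hβ : β = DBCD.stepBeta C s τ (DBCD.xi P 𝒥))
    (h : DBCD.BlockSpace d → DBCD.BlockSpace d) (hh : DBCD.IsBlockUpdate B f Om β L h)
    (xstar : DBCD.BlockSpace d)
    (hxstar : IsMinOn (DBCD.objective f Om) Set.univ xstar)
    (hfin : DBCD.objective f Om xstar ≠ ⊤)
    (x₀ : DBCD.BlockSpace d) :
    (∀ k : ℕ, 1 ≤ k →
      ∫⁻ ω, DBCD.gap f Om (DBCD.iterate h Z x₀ k ω) ∂μ
        ≤ ENNReal.ofReal ((n : ℝ) / ((n : ℝ) + (C : ℝ) * (τ : ℝ) * (k : ℝ)))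
          * DBCD.initialError B f Om β L x₀ xstar) ∧
    (∀ ε : ℝ, 0 < ε → ∀ k : ℕ, 1 ≤ k →
      ENNReal.ofReal ((n : ℝ) / ((C : ℝ) * (τ : ℝ) * ε))
          * DBCD.initialError B f Om β L x₀ xstar ≤ (k : ℝ≥0∞) →
      ∫⁻ ω, DBCD.gap f Om (DBCD.iterate h Z x₀ k ω) ∂μ ≤ ENNReal.ofReal ε) := by
  have hrate := fun k => DBCD.lintegral_gap_le hB hf hOm hC hP hτ hτs hβ hh hxstar hfin hZ x₀ k
  refine ⟨fun k _ => hrate k, fun ε hε k hk hle => (hrate k).trans ?_⟩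
  have hC' : (0 : ℝ) < C := by exact_mod_cast hC
  have hτ' : (0 : ℝ) < τ := by exact_mod_cast hτ
  have hk' : (0 : ℝ) < k := by exact_mod_cast hk
  -- Dropping `n` from the denominator bounds the rate by `n / (C τ k)`, which is `ε / k` times the
  -- factor in the assumption on `k`.
  calc ENNReal.ofReal ((n : ℝ) / ((n : ℝ) + (C : ℝ) * (τ : ℝ) * (k : ℝ)))
          * DBCD.initialError B f Om β L x₀ xstar
      ≤ ENNReal.ofReal ((ε / k) * ((n : ℝ) / ((C : ℝ) * (τ : ℝ) * ε)))
          * DBCD.initialError B f Om β L x₀ xstar := by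
        gcongr
        have h1 : (ε / k) * ((n : ℝ) / ((C : ℝ) * (τ : ℝ) * ε)) = n / (C * τ * k) := by
          field_simp
        rw [h1]
        gcongr
        exact le_add_of_nonneg_left (Nat.cast_nonneg n)
    _ = ENNReal.ofReal (ε / k) * (ENNReal.ofReal ((n : ℝ) / ((C : ℝ) * (τ : ℝ) * ε))
          * DBCD.initialError B f Om β L x₀ xstar) := by
        rw [ENNReal.ofReal_mul (by positivity), mul_assoc]
    _ ≤ ENNReal.ofReal (ε / k) * k := by gcongr
    _ = ENNReal.ofReal ε := by
        rw [← ENNReal.ofReal_natCast, ← ENNReal.ofReal_mul (by positivity),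
          div_mul_cancel₀ _ hk'.ne']
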